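/- Let $\mathbb{X}\subseteq\mathbb{R}^d$, $\mathbb{Y}=\{+1,-1\}$, let $Q$ be a probability distribution on $\mathbb{X}\times\mathbb{Y}$ with input marginal $Q_X$, and let $(X_i,Y_i)_{i\ge 1}$ be i.i.d. from $Q$. Let $\Theta$ be a metric space with metric $\Delta$ and let $\mathcal{F}_0=\{f_\theta:\mathbb{X}\to[-1,1]\mid\theta\in\Theta\}$ be a class of measurable functions such that, with $\|g\|_Q^2=\int g^2\,dQ_X$: (i) $f_{\theta^*}$ is the regression function $x\mapsto\mathbb{E}[Y\mid X=x]$ for some $\theta^*\in\Theta$; (ii) $\|f_{\theta_1}-f_{\theta_2}\|_Q\neq 0$ for all $\theta_1\ne\theta_2$; (iii) there is $L>0$ with $\Delta(\theta_1,\theta_2)\le L\,\|f_{\theta_1}-f_{\theta_2}\|_Q$ for all $\theta_1,\theta_2\in\Theta$; (iv) $\mathcal{F}_0$ has finite pseudo-dimension, i.e. the class of the subgraphs $\{(x,t)\mid t\le f_\theta(x)\}$ has finite VC dimension. Let $m\ge1$ and $q\le m$ be integers. For each $n$ let $U_{i,j}$ ($i\le n$, $1\le j\le m-1$) be i.i.d.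 uniform on $[-1,1]$ and $\pi$ a uniformly random permutation of $\{1,\dots,m\}$, such that the first $n$ observations, $(U_{i,j})$ and $\pi$ are independent. For $\theta\in\Theta$ let $Y_{i,0}(\theta)=Y_i$ and $Y_{i,j}(\theta)=\operatorname{sign}(f_\theta(X_i)+U_{i,j})$ for $1\le j\le m-1$, where $\operatorname{sign}(0)=+1$. Let $f^{(j)}_{\theta,n}$ be the empirical risk minimizer over $\mathcal{F}_0$ for the sample $\{(X_i,Y_{i,j}(\theta))\}_{i=1}^n$, that is, the minimizer of $\frac1n\sum_{i=1}^n(f(X_i)-Y_{i,j}(\theta))^2$ over $f\in\mathcal{F}_0$ that a fixed measurable selection assigns to the sample; such a selection is assumed to exist, uniqueness of minimizers is not assumed. Put $$Z_n^{(j)}(\theta)=\frac1n\sum_{i=1}^n\bigl(f_\theta(X_i)-f^{(j)}_{\theta,n}(X_i)\bigr)^2,\qquad 0\le j\le m-1,$$ and write $Z_n^{(j)}(\theta)\prec_\pi Z_n^{(0)}(\theta)$ if $Z_n^{(j)}(\theta)<Z_n^{(0)}(\theta)$, or $Z_n^{(j)}(\theta)=Z_n^{(0)}(\theta)$ and $\pi(j)<\pi(m)$.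 The confidence region is $$\Theta_n^{(1)}=\Bigl\{\theta\in\Theta\ \Big|\ 1+\#\{1\le j\le m-1 : Z_n^{(j)}(\theta)\prec_\pi Z_n^{(0)}(\theta)\}\le q\Bigr\}.$$ Assume that the suprema over the class of the centered empirical averages and of the empirical averages with signs are measurable up to null sets, for the three classes of functions $x\mapsto(f_{\theta_1}(x)-f_{\theta_2}(x))^2$, $(x,y)\mapsto(f_\theta(x)-y)^2$ and $(x,u)\mapsto(f_{\theta_1}(x)-\operatorname{sign}(f_{\theta_2}(x)+u))^2$, under i.i.d. samples from $Q_X$, $Q$ and $Q_X\otimes\mathrm{Uniform}[-1,1]$ respectively. Then $\mathbb{P}(\theta^*\in\Theta_n^{(1)})=q/m$ for every $n\in\mathbb{N}$. If in addition $q<m$, then for every $\varepsilon>0$, with $B(\theta^*,\varepsilon)=\{\theta\in\Theta\mid\Delta(\theta,\theta^*)<\varepsilon\}$, $$\mathbb{P}\Bigl(\bigcup_{n=1}^\infty\bigcap_{k=n}^\infty\bigl\{\Theta_k^{(1)}\subseteq B(\theta^*,\varepsilon)\bigr\}\Bigr)=1.$$ -/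

import Mathlib

open MeasureTheory ProbabilityTheory Filter
open scoped ENNReal

noncomputable section

namespace ERMRegion

/-- The binary output space `{+1, -1}`, as a subtype of the reals. -/
abbrev Label : Type := {y : ℝ // y = 1 ∨ y = -1}

/-- The sign with values in `{+1, -1}`, where the sign of zero is `+1`. -/
def signLabel (t : ℝ) : Label :=
  if 0 ≤ t then ⟨1, Or.inl rfl⟩ else ⟨-1, Or.inr rfl⟩

/-- The uniform distribution on `[-1, 1]`. -/
def uniformLaw : Measure ℝ := ProbabilityTheory.cond volume (Set.Icc (-1 : ℝ) 1)

/-- Permutations of a finite set carry the discrete sigma-algebra. -/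
instance permMeasurableSpace (m : ℕ) : MeasurableSpace (Equiv.Perm (Fin m)) := ⊤

section VC

variable {β : Type*}

/-- `𝒜` shatters the finite set `C`: every subset of `C` is the trace of a member of `𝒜`. -/
def Shatters (𝒜 : Set (Set β)) (C : Finset β) : Prop :=
  ∀ C₀ : Set β, C₀ ⊆ (C : Set β) → ∃ A ∈ 𝒜, A ∩ (C : Set β) = C₀

/-- The VC dimension: the supremum of the cardinalities of the shattered finite sets. -/
def vcDim (𝒜 : Set (Set β)) : ℕ∞ :=
  ⨆ (C : Finset β) (_ : Shatters 𝒜 C), (C.card : ℕ∞)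

/-- The subgraph `{(x, t) | t ≤ h x}`. -/
def subgraph (h : β → ℝ) : Set (β × ℝ) := {p | p.2 ≤ h p.1}

/-- The pseudo-dimension of a class of real functions: the VC dimension of its subgraphs. -/
def pseudoDim (H : Set (β → ℝ)) : ℕ∞ := vcDim (subgraph '' H)

end VC

section Regression

variable {X : Type*} [MeasurableSpace X]

/-- `g` is (a version of) the regression function `x ↦ E[Y | X = x]` of a pair with law `Q`. -/
def IsRegressionFunction (Q : Measure (X × Label)) (g : X → ℝ) : Prop :=
  Measurable g ∧
    Q[fun p : X × Label => (p.2 : ℝ) |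
        MeasurableSpace.comap (Prod.fst : X × Label → X) inferInstance]
      =ᵐ[Q] fun p => g p.1

/-- The squared distance of two functions in `L²(Q_X)`, where `Q_X = Q.fst` is the input law. -/
def sqDistQ (Q : Measure (X × Label)) (g h : X → ℝ) : ℝ := ∫ x, (g x - h x) ^ 2 ∂Q.fst

/-- The distance of two functions in `L²(Q_X)`. -/
def distQ (Q : Measure (X × Label)) (g h : X → ℝ) : ℝ := Real.sqrt (sqDistQ Q g h)

end Regression

section ERM

variable {X Θ : Type*}

/-- The empirical risk of `g` on the sample `D`. -/
def empRisk {n : ℕ} (D : Fin n → X × Label) (g : X → ℝ) : ℝ :=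
  (1 / (n : ℝ)) * ∑ i, (g (D i).1 - ((D i).2 : ℝ)) ^ 2

/-- `fhat` is a measurable empirical risk minimizer over the class `{f θ | θ}`: it chooses, for
every sample `D` of every size `n`, a minimizer `fhat n D` of the empirical risk over the class. -/
structure IsERM [MeasurableSpace X] (f : Θ → X → ℝ)
    (fhat : (n : ℕ) → (Fin n → X × Label) → X → ℝ) : Prop where
  mem_class : ∀ n D, fhat n D ∈ Set.range f
  minimizes : ∀ n D θ, empRisk D (fhat n D) ≤ empRisk D (f θ)
  measurable : ∀ n, Measurable fun p : (Fin n → X × Label) × X => fhat n p.1 p.2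

/-- The reference variable: the empirical squared distance between the candidate `g` and the
empirical risk minimizer computed from the sample `D`. -/
def refVar (fhat : (n : ℕ) → (Fin n → X × Label) → X → ℝ) (g : X → ℝ) {n : ℕ}
    (D : Fin n → X × Label) : ℝ :=
  (1 / (n : ℝ)) * ∑ i, (g (D i).1 - fhat n D (D i).1) ^ 2

/-- The alternative sample obtained from `D` by replacing the label of the input `X_i` by
`sign (g X_i + u_i)`. -/
def resample (g : X → ℝ) {n : ℕ} (D : Fin n → X × Label) (u : Fin n → ℝ) :
    Fin n → X × Label :=
  fun i => ((D i).1, signLabel (g (D i).1 + u i))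

/-- The tie-breaking order on pairs (reference variable, tag). -/
def TagLT {m : ℕ} (a b : ℝ × Fin m) : Prop := a.1 < b.1 ∨ (a.1 = b.1 ∧ a.2 < b.2)

open Classical in
/-- The rank of the original sample `D` among the `m` samples `D, D_1, …, D_{m-1}`, where `D_j` is
the alternative sample generated by `g` with the variables `u j`. With `Fin m` standing for
`{1, …, m}` in increasing order, the tag of `D` is `σ(m)` and the tag of `D_j` is `σ(j)`. -/
def rankStat {m : ℕ} [NeZero m] (fhat : (n : ℕ) → (Fin n → X × Label) → X → ℝ) (g : X → ℝ)
    {n : ℕ} (D : Fin n → X × Label) (u : Fin (m - 1) → Fin n → ℝ)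
    (σ : Equiv.Perm (Fin m)) : ℕ :=
  1 + ∑ j : Fin (m - 1),
    if TagLT (refVar fhat g (resample g D (u j)), σ (Fin.castLE (Nat.sub_le m 1) j))
        (refVar fhat g D, σ ⟨m - 1, Nat.sub_one_lt (NeZero.ne m)⟩)
    then 1 else 0

/-- The ERM-based confidence region: the parameters whose rank is at most `q`. -/
def ermRegion {m : ℕ} [NeZero m] (q : ℕ) (f : Θ → X → ℝ)
    (fhat : (n : ℕ) → (Fin n → X × Label) → X → ℝ) {n : ℕ} (D : Fin n → X × Label)
    (u : Fin (m - 1) → Fin n → ℝ) (σ : Equiv.Perm (Fin m)) : Set Θ :=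
  {θ | rankStat fhat (f θ) D u σ ≤ q}

end ERM

section Sampling

variable {Ω X : Type*} [MeasurableSpace Ω] [MeasurableSpace X]

/-- The sample `(X_i, Y_i)`, `i = 0, 1, 2, …`, is i.i.d. with law `Q`. -/
structure IsIIDSample (μ : Measure Ω) (Q : Measure (X × Label)) (S : ℕ → Ω → X × Label) :
    Prop where
  measurable : ∀ i, Measurable (S i)
  law : ∀ i, μ.map (S i) = Q
  indep : iIndepFun S μ

/-- The artificial randomness of the algorithm. For each sample size `n` the variables
`U n · j i` (`i < n`, `j < m - 1`) are i.i.d. uniform on `[-1, 1]`, the permutation `π n` is uniform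
on the symmetric group, and the first `n` observations, `U n` and `π n` are independent. Nothing is
said about the joint law for different `n`: the variables may be reused or drawn afresh. -/
structure IsStemSample (m : ℕ) (μ : Measure Ω) (S : ℕ → Ω → X × Label)
    (U : (n : ℕ) → Ω → Fin (m - 1) → Fin n → ℝ) (π : (n : ℕ) → Ω → Equiv.Perm (Fin m)) :
    Prop where
  measurable_U : ∀ n, Measurable (U n)
  measurable_π : ∀ n, Measurable (π n)
  law_U : ∀ n, μ.map (U n) = Measure.pi fun _ => Measure.pi fun _ => uniformLaw
  law_π : ∀ n σ, μ {ω | π n ω = σ} = ((m.factorial : ℕ) : ℝ≥0∞)⁻¹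
  indep_U : ∀ n, IndepFun (fun ω (i : Fin n) => S i ω) (U n) μ
  indep_π : ∀ n, IndepFun (fun ω => (fun i : Fin n => S i ω, U n ω)) (π n) μ

end Sampling

section Suprema

/-- Measurability (up to null sets) of the suprema of the empirical process of the class
`{h i | i}` under `P`: the uniform deviation of the averages from the expectations, and the
suprema of the averages with signs (these include the difference of the averages over two
independent samples). -/
structure MeasurableSuprema {ι Z : Type*} [MeasurableSpace Z] (P : Measure Z) (h : ι → Z → ℝ) :
    Prop where
  deviation : ∀ n : ℕ, AEMeasurable
    (fun z : Fin n → Z => ⨆ i, |(1 / (n : ℝ)) * ∑ k, h i (z k) - ∫ w, h i w ∂P|)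
    (Measure.pi fun _ => P)
  signed : ∀ (n : ℕ) (s : Fin n → Label), AEMeasurable
    (fun z : Fin n → Z => ⨆ i, |(1 / (n : ℝ)) * ∑ k, (s k : ℝ) * h i (z k)|)
    (Measure.pi fun _ => P)

variable {X Θ : Type*}

/-- The squared differences of two members of the class, as functions of the input. -/
def sqDiffClass (f : Θ → X → ℝ) (p : Θ × Θ) (x : X) : ℝ := (f p.1 x - f p.2 x) ^ 2

/-- The squared losses of the members of the class on an observation `(x, y)`. -/
def lossClass (f : Θ → X → ℝ) (θ : Θ) (z : X × Label) : ℝ := (f θ z.1 - (z.2 : ℝ)) ^ 2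

/-- The squared losses of the members of the class on resampled observations
`(x, sign (f θ x + u))`, as functions of `(x, u)`; the candidate `θ` varies too. -/
def resampledLossClass (f : Θ → X → ℝ) (p : Θ × Θ) (z : X × ℝ) : ℝ :=
  (f p.1 z.1 - (signLabel (f p.2 z.1 + z.2) : ℝ)) ^ 2

end Suprema

end ERMRegion

end

open ERMRegion

/-! Coverage. If Y given X has mean f_θ*(X), then sign(f_θ*(X) + U) with U uniform on [-1, 1] has
the same conditional law, since it equals +1 with probability (1 + f_θ*(X))/2 (`map_labelled_eq`).
At θ* the original sample is therefore equivalent to one more sample labelled with fresh uniform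
variables, and given the inputs the m reference variables are i.i.d. The tags break all ties, so on
every outcome exactly q of the m ranks are at most q; by symmetry each rank is at most q with
probability q/m (`prod_tagRank_le`, `measure_rankStat_le`).

Consistency. The population risk of a function is its squared L² distance d to a target plus a
constant. The target is f_θ* for the original sample and the candidate f_θ itself for an alternative
sample. If all empirical averages over the three classes are within η of their expectations, every
empirical risk minimizer is within 2η of its target in d. Hence Z⁽ʲ⁾(θ) ≤ 3η for j ≥ 1, whereas
Z⁽⁰⁾(θ) ≥ d(f_θ, f_θ*)/2 - 3η. Once d(f_θ, f_θ*) > 12η, all alternatives strictly precede the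
original and the rank is m > q (`rankStat_eq_of_deviation_le`). The inverse Lipschitz condition
converts this into a statement about Δ.

Uniform deviations. Sauer's lemma turns finite pseudo-dimension into polynomial covers on samples
(`exists_cover`). Symmetrization and Hoeffding's inequality for random signs then bound the
deviation probabilities by a polynomial times an exponential (`tsum_measure_deviation_ne_top`).
These are summable, so the Borel–Cantelli lemma applies whatever the dependence between different n.
In the resampled class the candidate also sits inside the sign, so covers must preserve signs as
well as values. -/

namespace ERMRegion

/-! ### Traces of a class of finite pseudo-dimension -/

/-- Sauer's lemma for a class of sets whose shattered finite sets have at most `D` elements: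
finitely many members represent all traces on a finite set, their number being polynomial. -/
theorem exists_traceRepresentatives {β ι : Type*} [Nonempty ι] (F : ι → Set β) {D : ℕ}
    (hD : ∀ C : Finset β, Shatters (Set.range F) C → C.card ≤ D) (A : Finset β) :
    ∃ T : Finset ι, T.card ≤ (D + 1) * (A.card + 1) ^ D ∧
      ∀ i, ∃ j ∈ T, ∀ a ∈ A, a ∈ F i ↔ a ∈ F j := by
  classical
  let tr : ι → Finset β := fun i => A.filter (· ∈ F i)
  let 𝒯 : Finset (Finset β) := A.powerset.filter (· ∈ Set.range tr)
  have hcard : 𝒯.card ≤ (D + 1) * (A.card + 1) ^ D := by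
    -- A set shattered by the traces lies in A and is shattered by the class itself, so it has at
    -- most D elements. A family of sets has at most as many members as sets that it shatters.
    have hsub : 𝒯.shatterer ⊆ (Finset.range (D + 1)).biUnion fun k => A.powersetCard k := by
      intro C hC
      rw [Finset.mem_shatterer] at hC
      obtain ⟨u, hu, hCu⟩ := hC subset_rfl
      have hCA : C ⊆ A := (Finset.inter_eq_left.mp hCu).trans
        (Finset.mem_powerset.mp (Finset.mem_filter.mp hu).1)
      have hle : C.card ≤ D := by
        refine hD C fun C₀ hC₀ => ?_
        obtain ⟨u, hu, hCu⟩ := hC (Finset.filter_subset (· ∈ C₀) C)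
        obtain ⟨i, rfl⟩ := (Finset.mem_filter.mp hu).2
        refine ⟨F i, ⟨i, rfl⟩, ?_⟩
        ext a
        have ha := Finset.ext_iff.mp hCu a
        simp only [tr, Finset.mem_inter, Finset.mem_filter] at ha
        simp only [Set.mem_inter_iff, Finset.mem_coe]
        constructor
        · rintro ⟨h1, h2⟩
          exact (ha.mp ⟨h2, hCA h2, h1⟩).2
        · intro h
          have h2 : a ∈ C := hC₀ h
          exact ⟨(ha.mpr ⟨h2, h⟩).2.2, h2⟩
      exact Finset.mem_biUnion.mpr ⟨C.card, Finset.mem_range.mpr (by omega),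
        Finset.mem_powersetCard.mpr ⟨hCA, rfl⟩⟩
    calc 𝒯.card ≤ 𝒯.shatterer.card := Finset.card_le_card_shatterer 𝒯
      _ ≤ _ := Finset.card_le_card hsub
      _ ≤ (Finset.range (D + 1)).card * (A.card + 1) ^ D := by
          refine Finset.card_biUnion_le_card_mul _ _ _ fun k hk => ?_
          rw [Finset.card_powersetCard]
          refine (Nat.choose_le_pow _ _).trans ((Nat.pow_le_pow_left (Nat.le_succ _) k).trans ?_)
          exact Nat.pow_le_pow_right (Nat.succ_pos _) (by simpa [Nat.lt_succ_iff] using hk)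
      _ = _ := by rw [Finset.card_range]
  have htr : ∀ i, tr i ∈ 𝒯 := fun i =>
    Finset.mem_filter.mpr ⟨Finset.mem_powerset.mpr (Finset.filter_subset _ _), i, rfl⟩
  -- One member of the class is chosen for each trace.
  refine ⟨𝒯.image (Function.invFun tr), Finset.card_image_le.trans hcard, fun i =>
    ⟨_, Finset.mem_image_of_mem _ (htr i), fun a ha => ?_⟩⟩
  have h := Finset.ext_iff.mp (Function.invFun_eq (f := tr) ⟨i, rfl⟩) a
  simpa [tr, ha] using h.symm

theorem exists_card_le_of_pseudoDim_lt_top {β : Type*} {H : Set (β → ℝ)} (h : pseudoDim H < ⊤) :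
    ∃ D : ℕ, ∀ C : Finset (β × ℝ), Shatters (subgraph '' H) C → C.card ≤ D := by
  obtain ⟨D, hD⟩ := ENat.ne_top_iff_exists.mp h.ne
  refine ⟨D, fun C hC => ?_⟩
  have : (C.card : ℕ∞) ≤ pseudoDim H := le_iSup₂ (f := fun (C : Finset (β × ℝ))
    (_ : Shatters (subgraph '' H) C) => (C.card : ℕ∞)) C hC
  rw [← hD] at this
  exact_mod_cast this

/-- Two numbers in `[-1, 1]` that lie above the same points of a grid of mesh `δ` are `δ`-close. -/
theorem abs_sub_le_of_grid {δ a b : ℝ} (hδ : 0 < δ) {K : ℕ} (hK : 2 < K * δ)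
    (ha : a ∈ Set.Icc (-1 : ℝ) 1) (hb : b ∈ Set.Icc (-1 : ℝ) 1)
    (h : ∀ l ∈ Finset.range (K + 1), (-1 + l * δ ≤ a ↔ -1 + l * δ ≤ b)) : |a - b| ≤ δ := by
  have key : ∀ a b : ℝ, a ∈ Set.Icc (-1 : ℝ) 1 → b ∈ Set.Icc (-1 : ℝ) 1 →
      (∀ l ∈ Finset.range (K + 1), (-1 + l * δ ≤ a ↔ -1 + l * δ ≤ b)) → a - b ≤ δ := by
    intro a b ha hb h
    -- The largest grid point below a also lies below b, and a exceeds it by less than δ.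
    set l := ⌊(a + 1) / δ⌋₊
    have h0 : 0 ≤ (a + 1) / δ := div_nonneg (by linarith [ha.1]) hδ.le
    have hl : (l : ℝ) * δ ≤ a + 1 := (le_div_iff₀ hδ).mp (Nat.floor_le h0)
    have hl' : a + 1 < (l + 1) * δ := (div_lt_iff₀ hδ).mp (Nat.lt_floor_add_one _)
    have hlK : l < K := by
      have : (l : ℝ) * δ < K * δ := by linarith [ha.2]
      exact_mod_cast lt_of_mul_lt_mul_right this hδ.le
    have := (h l (Finset.mem_range.mpr (by omega))).mp (by linarith)
    linarith
  rw [abs_le]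
  constructor
  · linarith [key b a hb ha fun l hl => (h l hl).symm]
  · exact key a b ha hb h

/-- A class of finite pseudo-dimension has polynomial covers in the uniform norm on samples, and
the members of the cover may be chosen to have the same signs after shifts. -/
theorem exists_cover {X Θ : Type*} [Nonempty Θ] {f : Θ → X → ℝ}
    (hf : ∀ θ x, f θ x ∈ Set.Icc (-1 : ℝ) 1) (hdim : pseudoDim (Set.range f) < ⊤)
    {δ : ℝ} (hδ : 0 < δ) :
    ∃ C D : ℕ, ∀ (n : ℕ) (x : Fin n → X) (u : Fin n → ℝ), ∃ T : Finset Θ,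
      T.card ≤ C * (n + 1) ^ D ∧
      ∀ θ, ∃ θ' ∈ T, ∀ k, |f θ (x k) - f θ' (x k)| ≤ δ ∧
        (0 ≤ f θ (x k) + u k ↔ 0 ≤ f θ' (x k) + u k) := by
  classical
  obtain ⟨D, hD⟩ := exists_card_le_of_pseudoDim_lt_top hdim
  obtain ⟨K, hK⟩ := exists_nat_gt (2 / δ)
  rw [div_lt_iff₀ hδ] at hK
  refine ⟨(D + 1) * (K + 2) ^ D, D, fun n x u => ?_⟩
  -- Traces on the grid points control the values up to δ; the point (x k, -u k) lies in the
  -- subgraph exactly when the shifted value is nonnegative.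
  let A : Finset (X × ℝ) :=
    (Finset.univ ×ˢ Finset.range (K + 1)).image
      (fun p : Fin n × ℕ => (x p.1, -1 + (p.2 : ℝ) * δ)) ∪
    Finset.univ.image fun k => (x k, -u k)
  have hA : A.card ≤ n * (K + 2) := by
    refine (Finset.card_union_le _ _).trans ?_
    have h1 := Finset.card_image_le (s := Finset.univ ×ˢ Finset.range (K + 1))
      (f := fun p : Fin n × ℕ => (x p.1, -1 + (p.2 : ℝ) * δ))
    have h2 := Finset.card_image_le (s := Finset.univ) (f := fun k => (x k, -u k))
    simp only [Finset.card_product, Finset.card_univ, Fintype.card_fin, Finset.card_range] at h1 h2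
    linarith
  obtain ⟨T, hT, hrep⟩ := exists_traceRepresentatives (fun θ => subgraph (f θ)) (D := D)
    (fun C hC => hD C (by rwa [← Set.range_comp])) A
  refine ⟨T, hT.trans ?_, fun θ => ?_⟩
  · rw [mul_assoc, ← mul_pow]
    gcongr
    nlinarith
  · obtain ⟨θ', hθ', h⟩ := hrep θ
    refine ⟨θ', hθ', fun k => ⟨?_, ?_⟩⟩
    · refine abs_sub_le_of_grid hδ hK (hf _ _) (hf _ _) fun l hl => ?_
      exact h (x k, -1 + l * δ) (Finset.mem_union_left _ (Finset.mem_image.mpr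
        ⟨(k, l), Finset.mem_product.mpr ⟨Finset.mem_univ _, hl⟩, rfl⟩))
    · have := h (x k, -u k) (Finset.mem_union_right _
        (Finset.mem_image_of_mem _ (Finset.mem_univ k)))
      simpa only [subgraph, Set.mem_ofPred_eq, neg_le_iff_add_nonneg] using this

/-- Polynomial covering numbers in the uniform norm on samples. -/
def HasPolynomialCovers {ι Z : Type*} (h : ι → Z → ℝ) : Prop :=
  ∀ δ : ℝ, 0 < δ → ∃ C D : ℕ, ∀ (n : ℕ) (z : Fin n → Z), ∃ T : Finset ι,
    T.card ≤ C * (n + 1) ^ D ∧ ∀ i, ∃ j ∈ T, ∀ k, |h i (z k) - h j (z k)| ≤ δ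

theorem abs_sq_sub_sq_le {a b y δ : ℝ} (ha : a ∈ Set.Icc (-1 : ℝ) 1)
    (hb : b ∈ Set.Icc (-1 : ℝ) 1) (hy : y ∈ Set.Icc (-1 : ℝ) 1) (hab : |a - b| ≤ δ) :
    |(a - y) ^ 2 - (b - y) ^ 2| ≤ 4 * δ := by
  have h : (a - y) ^ 2 - (b - y) ^ 2 = (a + b - 2 * y) * (a - b) := by ring
  rw [h, abs_mul]
  refine mul_le_mul ?_ hab (abs_nonneg _) (by norm_num)
  rw [abs_le]
  constructor <;> linarith [ha.1, ha.2, hb.1, hb.2, hy.1, hy.2]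

theorem label_mem_Icc (y : Label) : (y : ℝ) ∈ Set.Icc (-1 : ℝ) 1 := by
  obtain ⟨y, rfl | rfl⟩ := y <;> norm_num

theorem card_product_self_le {Θ : Type*} {T : Finset Θ} {C D n : ℕ}
    (hT : T.card ≤ C * (n + 1) ^ D) :
    (T ×ˢ T).card ≤ C ^ 2 * (n + 1) ^ (2 * D) := by
  rw [Finset.card_product, pow_mul', ← mul_pow, ← sq]
  exact Nat.pow_le_pow_left hT 2

/-! ### Covers of the three loss classes -/

section Covers

variable {X Θ : Type*} [Nonempty Θ] {f : Θ → X → ℝ}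

theorem hasPolynomialCovers_lossClass (hf : ∀ θ x, f θ x ∈ Set.Icc (-1 : ℝ) 1)
    (hdim : pseudoDim (Set.range f) < ⊤) : HasPolynomialCovers (lossClass f) := by
  intro δ hδ
  obtain ⟨C, D, h⟩ := exists_cover hf hdim (δ := δ / 4) (by positivity)
  refine ⟨C, D, fun n z => ?_⟩
  obtain ⟨T, hT, hrep⟩ := h n (fun k => (z k).1) 0
  refine ⟨T, hT, fun θ => ?_⟩
  obtain ⟨θ', hθ', h'⟩ := hrep θ
  refine ⟨θ', hθ', fun k => ?_⟩
  have := abs_sq_sub_sq_le (hf θ (z k).1) (hf θ' _) (label_mem_Icc (z k).2) (h' k).1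
  unfold lossClass
  linarith

theorem hasPolynomialCovers_sqDiffClass (hf : ∀ θ x, f θ x ∈ Set.Icc (-1 : ℝ) 1)
    (hdim : pseudoDim (Set.range f) < ⊤) : HasPolynomialCovers (sqDiffClass f) := by
  intro δ hδ
  -- The two functions are replaced one after the other, each at a cost of 4 · δ/8.
  obtain ⟨C, D, h⟩ := exists_cover hf hdim (δ := δ / 8) (by positivity)
  refine ⟨C ^ 2, 2 * D, fun n z => ?_⟩
  obtain ⟨T, hT, hrep⟩ := h n z 0
  refine ⟨T ×ˢ T, card_product_self_le hT, fun p => ?_⟩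
  obtain ⟨θ₁, hθ₁, h₁⟩ := hrep p.1
  obtain ⟨θ₂, hθ₂, h₂⟩ := hrep p.2
  refine ⟨(θ₁, θ₂), Finset.mem_product.mpr ⟨hθ₁, hθ₂⟩, fun k => ?_⟩
  have e₁ := abs_sq_sub_sq_le (hf p.1 (z k)) (hf θ₁ _) (hf p.2 (z k)) (h₁ k).1
  have e₂ := abs_sq_sub_sq_le (hf p.2 (z k)) (hf θ₂ _) (hf θ₁ (z k)) (h₂ k).1
  rw [abs_le] at e₁ e₂ ⊢
  unfold sqDiffClass
  constructor <;> nlinarith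

theorem hasPolynomialCovers_resampledLossClass (hf : ∀ θ x, f θ x ∈ Set.Icc (-1 : ℝ) 1)
    (hdim : pseudoDim (Set.range f) < ⊤) : HasPolynomialCovers (resampledLossClass f) := by
  intro δ hδ
  obtain ⟨C, D, h⟩ := exists_cover hf hdim (δ := δ / 4) (by positivity)
  refine ⟨C ^ 2, 2 * D, fun n z => ?_⟩
  obtain ⟨T, hT, hrep⟩ := h n (fun k => (z k).1) fun k => (z k).2
  refine ⟨T ×ˢ T, card_product_self_le hT, fun p => ?_⟩
  obtain ⟨θ₁, hθ₁, h₁⟩ := hrep p.1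
  obtain ⟨θ₂, hθ₂, h₂⟩ := hrep p.2
  refine ⟨(θ₁, θ₂), Finset.mem_product.mpr ⟨hθ₁, hθ₂⟩, fun k => ?_⟩
  -- The sign is discontinuous, so uniform closeness would not suffice here: the representative of
  -- the candidate must produce the very same labels.
  have hs : signLabel (f p.2 (z k).1 + (z k).2) = signLabel (f θ₂ (z k).1 + (z k).2) := by
    simp only [signLabel, (h₂ k).2]
  have := abs_sq_sub_sq_le (hf p.1 (z k).1) (hf θ₁ _)
    (label_mem_Icc (signLabel (f p.2 (z k).1 + (z k).2))) (h₁ k).1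
  unfold resampledLossClass
  rw [← hs]
  linarith

end Covers

/-! ### A uniform law of large numbers with summable tails -/

/-- The sign attached to a boolean. -/
def boolLabel (b : Bool) : Label := if b then ⟨1, Or.inl rfl⟩ else ⟨-1, Or.inr rfl⟩

/-- Chernoff's method in counting form: the exponential sum over all sign patterns factors into
terms 2 cosh(l a_k), and cosh x ≤ exp(x²/2). -/
theorem card_signs_ge_le {n : ℕ} (a : Fin n → ℝ) {c t : ℝ} (hc : 0 < c) (ha : ∀ k, |a k| ≤ c)
    (ht : 0 < t) :
    ((Finset.univ.filter fun s : Fin n → Bool =>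
      n * t ≤ ∑ k, (boolLabel (s k) : ℝ) * a k).card : ℝ)
      ≤ 2 ^ n * Real.exp (-(n * (t ^ 2 / (2 * c ^ 2)))) := by
  -- This minimizes the exponent n(l²c²/2 - lt).
  set l : ℝ := t / c ^ 2
  have hl : 0 < l := by positivity
  set E := Finset.univ.filter fun s : Fin n → Bool => n * t ≤ ∑ k, (boolLabel (s k) : ℝ) * a k
  have hsum : ∑ s : Fin n → Bool, Real.exp (l * ∑ k, (boolLabel (s k) : ℝ) * a k)
      ≤ 2 ^ n * Real.exp (n * (l ^ 2 * c ^ 2 / 2)) := by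
    calc ∑ s : Fin n → Bool, Real.exp (l * ∑ k, (boolLabel (s k) : ℝ) * a k)
        = ∑ s : Fin n → Bool, ∏ k, Real.exp (l * ((boolLabel (s k) : ℝ) * a k)) := by
          refine Finset.sum_congr rfl fun s _ => ?_
          rw [Finset.mul_sum, Real.exp_sum]
      _ = ∏ k, ∑ b : Bool, Real.exp (l * ((boolLabel b : ℝ) * a k)) :=
          (Fintype.prod_sum (fun k (b : Bool) => Real.exp (l * ((boolLabel b : ℝ) * a k)))).symm
      _ = ∏ k, (2 * Real.cosh (l * a k)) := by
          refine Finset.prod_congr rfl fun k _ => ?_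
          rw [Fintype.sum_bool, Real.cosh_eq]
          simp only [boolLabel]
          norm_num
          ring
      _ ≤ ∏ _k : Fin n, (2 * Real.exp (l ^ 2 * c ^ 2 / 2)) := by
          refine Finset.prod_le_prod (fun k _ => by positivity) fun k _ => ?_
          refine mul_le_mul_of_nonneg_left ((Real.cosh_le_exp_half_sq _).trans ?_) (by norm_num)
          rw [Real.exp_le_exp, mul_pow]
          have : a k ^ 2 ≤ c ^ 2 := sq_le_sq' (abs_le.mp (ha k)).1 (abs_le.mp (ha k)).2
          gcongr
      _ = _ := by
          rw [Finset.prod_const, Finset.card_univ, Fintype.card_fin, mul_pow, ← Real.exp_nat_mul]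
  have hmarkov : (E.card : ℝ) * Real.exp (l * (n * t))
      ≤ ∑ s : Fin n → Bool, Real.exp (l * ∑ k, (boolLabel (s k) : ℝ) * a k) := by
    calc (E.card : ℝ) * Real.exp (l * (n * t)) = ∑ _s ∈ E, Real.exp (l * (n * t)) := by
          rw [Finset.sum_const, nsmul_eq_mul]
      _ ≤ ∑ s ∈ E, Real.exp (l * ∑ k, (boolLabel (s k) : ℝ) * a k) := by
          refine Finset.sum_le_sum fun s hs => ?_
          rw [Real.exp_le_exp]
          exact mul_le_mul_of_nonneg_left (Finset.mem_filter.mp hs).2 hl.le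
      _ ≤ _ := Finset.sum_le_sum_of_subset_of_nonneg (Finset.subset_univ _)
          fun s _ _ => (Real.exp_pos _).le
  have h := hmarkov.trans hsum
  rw [← le_div_iff₀ (Real.exp_pos _), mul_div_assoc, ← Real.exp_sub] at h
  have hexp : n * (l ^ 2 * c ^ 2 / 2) - l * (n * t) = -(n * (t ^ 2 / (2 * c ^ 2))) := by
    simp only [l]
    field_simp
    ring
  rwa [hexp] at h

/-- Hoeffding's inequality for averages with random signs. -/
theorem card_signs_abs_ge_le {n : ℕ} (a : Fin n → ℝ) {c t : ℝ} (hc : 0 < c)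
    (ha : ∀ k, |a k| ≤ c) (ht : 0 < t) :
    ((Finset.univ.filter fun s : Fin n → Bool =>
      n * t ≤ |∑ k, (boolLabel (s k) : ℝ) * a k|).card : ℝ)
      ≤ 2 ^ n * (2 * Real.exp (-(n * (t ^ 2 / (2 * c ^ 2))))) := by
  classical
  have h₁ := card_signs_ge_le a hc ha ht
  have h₂ := card_signs_ge_le (fun k => -a k) hc (fun k => by rw [abs_neg]; exact ha k) ht
  have hsub : (Finset.univ.filter fun s : Fin n → Bool =>
        n * t ≤ |∑ k, (boolLabel (s k) : ℝ) * a k|) ⊆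
      (Finset.univ.filter fun s : Fin n → Bool => n * t ≤ ∑ k, (boolLabel (s k) : ℝ) * a k) ∪
      (Finset.univ.filter fun s : Fin n → Bool => n * t ≤ ∑ k, (boolLabel (s k) : ℝ) * -a k) := by
    intro s hs
    simp only [mul_neg, Finset.sum_neg_distrib, Finset.mem_union, Finset.mem_filter,
      Finset.mem_univ, true_and] at hs ⊢
    exact le_abs.mp hs
  have h := Nat.cast_le (α := ℝ).mpr
    ((Finset.card_le_card hsub).trans (Finset.card_union_le _ _))
  rw [Nat.cast_add] at h
  linarith

/-- The event that the two halves of a double sample, after exchanges given by the signs `s`,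
have averages that differ by more than `t` for some member of the class. -/
def signedGap {ι Z : Type*} (h : ι → Z → ℝ) (t : ℝ) {n : ℕ} (s : Fin n → Bool) :
    Set (Fin n → Z × Z) :=
  {w | ∃ i, t < |(1 / (n : ℝ)) * ∑ k, (boolLabel (s k) : ℝ) * (h i (w k).1 - h i (w k).2)|}

/-- Few sign patterns give a large gap on a fixed double sample. -/
theorem card_signedGap_le {ι Z : Type*} {h : ι → Z → ℝ}
    (hb : ∀ i z, h i z ∈ Set.Icc (0 : ℝ) 4) {ε : ℝ}
    (hε : 0 < ε) {n N : ℕ} (w : Fin n → Z × Z) {T : Finset ι} (hT : T.card ≤ N)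
    (hcov : ∀ i, ∃ j ∈ T, ∀ k, |h i (w k).1 - h j (w k).1| ≤ ε / 8 ∧
      |h i (w k).2 - h j (w k).2| ≤ ε / 8) [DecidablePred fun s => w ∈ signedGap h (ε / 2) s] :
    ((Finset.univ.filter fun s : Fin n → Bool => w ∈ signedGap h (ε / 2) s).card : ℝ) ≤
      N * (2 ^ n * (2 * Real.exp (-(ε ^ 2 / 512 * n)))) := by
  classical
  have hsub : (Finset.univ.filter fun s : Fin n → Bool => w ∈ signedGap h (ε / 2) s) ⊆
      T.biUnion fun j => Finset.univ.filter fun s : Fin n → Bool =>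
        n * (ε / 4) ≤ |∑ k, (boolLabel (s k) : ℝ) * (h j (w k).1 - h j (w k).2)| := by
    intro s hs
    obtain ⟨i, hi⟩ := (Finset.mem_filter.mp hs).2
    obtain ⟨j, hj, hij⟩ := hcov i
    refine Finset.mem_biUnion.mpr ⟨j, hj, Finset.mem_filter.mpr ⟨Finset.mem_univ _, ?_⟩⟩
    rcases Nat.eq_zero_or_pos n with rfl | hn
    · simp
    have hn0 : (0 : ℝ) < n := by exact_mod_cast hn
    rw [abs_mul, abs_of_pos (by positivity), one_div, inv_mul_eq_div, lt_div_iff₀ hn0] at hi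
    -- Passing to the representative changes each summand by at most ε/8 + ε/8, so of the gap ε/2 at
    -- least ε/4 remains.
    have hdiff : |∑ k, (boolLabel (s k) : ℝ) * (h i (w k).1 - h i (w k).2) -
        ∑ k, (boolLabel (s k) : ℝ) * (h j (w k).1 - h j (w k).2)| ≤ n * (ε / 4) := by
      rw [← Finset.sum_sub_distrib]
      calc _ ≤ ∑ k : Fin n, |(boolLabel (s k) : ℝ) * (h i (w k).1 - h i (w k).2) -
            (boolLabel (s k) : ℝ) * (h j (w k).1 - h j (w k).2)| :=
            Finset.abs_sum_le_sum_abs _ _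
        _ ≤ ∑ _k : Fin n, ε / 4 := by
            refine Finset.sum_le_sum fun k _ => ?_
            obtain ⟨h1, h2⟩ := hij k
            rw [abs_le] at h1 h2 ⊢
            cases s k <;> simp only [boolLabel, if_true, Bool.false_eq_true, if_false] <;>
              constructor <;> linarith
        _ = _ := by simp
    have := abs_sub_abs_le_abs_sub (∑ k, (boolLabel (s k) : ℝ) * (h i (w k).1 - h i (w k).2))
      (∑ k, (boolLabel (s k) : ℝ) * (h j (w k).1 - h j (w k).2))
    linarith
  have hcard := (Finset.card_le_card hsub).trans Finset.card_biUnion_le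
  calc ((Finset.univ.filter fun s : Fin n → Bool => w ∈ signedGap h (ε / 2) s).card : ℝ)
      ≤ ∑ j ∈ T, ((Finset.univ.filter fun s : Fin n → Bool => n * (ε / 4) ≤
          |∑ k, (boolLabel (s k) : ℝ) * (h j (w k).1 - h j (w k).2)|).card : ℝ) := by
        exact_mod_cast hcard
    _ ≤ ∑ _j ∈ T, 2 ^ n * (2 * Real.exp (-(ε ^ 2 / 512 * n))) := by
        refine Finset.sum_le_sum fun j _ => ?_
        -- Differences of values in [0, 4] are bounded by c = 4, and t²/(2c²) = ε²/512.
        have := card_signs_abs_ge_le (fun k => h j (w k).1 - h j (w k).2) (c := 4) (t := ε / 4)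
          (by norm_num) (fun k => by
            rw [abs_le]
            constructor <;> linarith [(hb j (w k).1).1, (hb j (w k).1).2, (hb j (w k).2).1,
              (hb j (w k).2).2]) (by positivity)
        refine this.trans (le_of_eq ?_)
        congr 4
        ring
    _ = T.card * (2 ^ n * (2 * Real.exp (-(ε ^ 2 / 512 * n)))) := by
        rw [Finset.sum_const, nsmul_eq_mul]
    _ ≤ _ := by gcongr

/-! ### Symmetrization and the tail bound -/

section UniformLaw

variable {ι Z : Type*} [MeasurableSpace Z] {P : Measure Z} [IsProbabilityMeasure P]

/-- Chebyshev's inequality for the average of a bounded function on an i.i.d. sample. -/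
theorem half_le_measure_average {g : Z → ℝ} (hg : Measurable g)
    (hb : ∀ z, g z ∈ Set.Icc (0 : ℝ) 4) {ε : ℝ} (hε : 0 < ε) {n : ℕ} (hn : 32 ≤ n * ε ^ 2) :
    2⁻¹ ≤ (Measure.pi fun _ : Fin n => P)
      {z | |(1 / (n : ℝ)) * ∑ k, g (z k) - ∫ w, g w ∂P| ≤ ε / 2} := by
  have hn0 : 0 < (n : ℝ) := by
    by_contra h
    have : (n : ℝ) = 0 := le_antisymm (not_lt.mp h) (Nat.cast_nonneg n)
    rw [this] at hn
    norm_num at hn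
  have hL : MemLp g 2 P := MemLp.of_bound hg.aestronglyMeasurable 4 (ae_of_all _ fun z => by
    rw [Real.norm_eq_abs, abs_le]; constructor <;> linarith [(hb z).1, (hb z).2])
  have hL' : ∀ k : Fin n, MemLp (fun z : Fin n → Z => g (z k)) 2 (Measure.pi fun _ => P) :=
    fun k => hL.comp_measurePreserving (measurePreserving_eval (fun _ => P) k)
  have hint : ∀ k : Fin n, ∫ z : Fin n → Z, g (z k) ∂(Measure.pi fun _ => P) = ∫ w, g w ∂P :=
    fun k => by
      have h := measurePreserving_eval (fun _ : Fin n => P) k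
      have := integral_map (μ := Measure.pi fun _ : Fin n => P) h.aemeasurable
        (f := g) hg.aestronglyMeasurable
      rw [h.map_eq] at this
      exact this.symm
  set V : (Fin n → Z) → ℝ := ∑ k, fun z => g (z k) with hV
  have hVL : MemLp V 2 (Measure.pi fun _ => P) := memLp_finsetSum' _ fun k _ => hL' k
  have hmean : ∫ z, V z ∂(Measure.pi fun _ => P) = n * ∫ w, g w ∂P := by
    simp only [hV, Finset.sum_apply]
    rw [integral_finsetSum _ fun k _ => (hL' k).integrable one_le_two]
    simp [hint]
  have hvar : Var[V; Measure.pi fun _ => P] ≤ n * 4 := by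
    rw [hV, variance_sum_pi (X := fun (_ : Fin n) => g) fun _ => hL, Finset.sum_const,
      Finset.card_univ, Fintype.card_fin, nsmul_eq_mul]
    gcongr
    have := variance_le_sq_of_bounded (μ := P) (X := g) (a := 0) (b := 4) (ae_of_all _ hb)
      hg.aemeasurable
    norm_num at this
    exact this
  -- The bound is at most 4n/(nε/2)² = 16/(nε²), which is at most 1/2 because nε² ≥ 32.
  have hcheb := meas_ge_le_variance_div_sq hVL (c := n * (ε / 2)) (by positivity)
  rw [hmean] at hcheb
  set G := {z : Fin n → Z | |(1 / (n : ℝ)) * ∑ k, g (z k) - ∫ w, g w ∂P| ≤ ε / 2}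
  have hGm : MeasurableSet G := measurableSet_le (by fun_prop) measurable_const
  have hcompl : (Measure.pi fun _ : Fin n => P) Gᶜ ≤ 2⁻¹ := by
    refine (measure_mono ?_).trans (hcheb.trans ?_)
    · intro z hz
      simp only [G, Set.mem_compl_iff, Set.mem_ofPred_eq, not_le] at hz
      have : (1 / (n : ℝ)) * ∑ k, g (z k) - ∫ w, g w ∂P
          = (1 / n) * (V z - n * ∫ w, g w ∂P) := by
        simp only [hV, Finset.sum_apply]
        field_simp
      rw [this, abs_mul, abs_of_pos (by positivity), one_div, inv_mul_eq_div,
        lt_div_iff₀ hn0] at hz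
      simp only [Set.mem_ofPred_eq]
      linarith
    · have : (2⁻¹ : ℝ≥0∞) = ENNReal.ofReal 2⁻¹ := by
        rw [ENNReal.ofReal_inv_of_pos two_pos, ENNReal.ofReal_ofNat]
      rw [this]
      refine ENNReal.ofReal_le_ofReal ?_
      rw [div_le_iff₀ (by positivity)]
      nlinarith
  have h1 : (1 : ℝ≥0∞) ≤ (Measure.pi fun _ : Fin n => P) G + 2⁻¹ := by
    rw [← measure_univ (μ := Measure.pi fun _ : Fin n => P), ← measure_add_measure_compl hGm]
    gcongr
  rw [← ENNReal.one_sub_inv_two]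
  exact tsub_le_iff_right.mpr h1

/-- Symmetrization by an independent copy of the sample. No measurability is required. -/
theorem measure_deviation_le_two_mul {h : ι → Z → ℝ} (hm : ∀ i, Measurable (h i))
    (hb : ∀ i z, h i z ∈ Set.Icc (0 : ℝ) 4) {ε : ℝ} (hε : 0 < ε) {n : ℕ}
    (hn : 32 ≤ n * ε ^ 2) :
    (Measure.pi fun _ : Fin n => P)
        {z | ∃ i, ε < |(1 / (n : ℝ)) * ∑ k, h i (z k) - ∫ w, h i w ∂P|} ≤
      2 * ((Measure.pi fun _ : Fin n => P).prod (Measure.pi fun _ : Fin n => P))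
        {p | ∃ i, ε / 2 < |(1 / (n : ℝ)) * ∑ k, (h i (p.1 k) - h i (p.2 k))|} := by
  set ν := Measure.pi fun _ : Fin n => P
  set A := {p : (Fin n → Z) × (Fin n → Z) |
    ∃ i, ε / 2 < |(1 / (n : ℝ)) * ∑ k, (h i (p.1 k) - h i (p.2 k))|}
  -- A measurable hull of the same measure makes Fubini and Markov available for an arbitrary class.
  set B := toMeasurable (ν.prod ν) A
  have hB : MeasurableSet B := measurableSet_toMeasurable _ _
  have hbad : {z | ∃ i, ε < |(1 / (n : ℝ)) * ∑ k, h i (z k) - ∫ w, h i w ∂P|} ⊆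
      {z | 2⁻¹ ≤ ν (Prod.mk z ⁻¹' B)} := by
    rintro z ⟨i, hi⟩
    -- For a bad z with witness i, at least half of the ghost samples z' have deviation at most ε/2
    -- for the same i, which leaves a gap above ε/2.
    refine (half_le_measure_average (hm i) (hb i) hε hn).trans (measure_mono fun z' hz' => ?_)
    refine subset_toMeasurable (ν.prod ν) A ⟨i, ?_⟩
    simp only [Set.mem_ofPred_eq] at hz'
    simp only [Finset.sum_sub_distrib, mul_sub]
    have := abs_sub_abs_le_abs_sub ((1 / (n : ℝ)) * ∑ k, h i (z k) - ∫ w, h i w ∂P)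
      ((1 / (n : ℝ)) * ∑ k, h i (z' k) - ∫ w, h i w ∂P)
    rw [sub_sub_sub_cancel_right] at this
    linarith
  have hmarkov := mul_meas_ge_le_lintegral (μ := ν) (measurable_measure_prodMk_left (ν := ν) hB) 2⁻¹
  rw [← Measure.prod_apply hB, measure_toMeasurable] at hmarkov
  calc ν _ ≤ ν {z | 2⁻¹ ≤ ν (Prod.mk z ⁻¹' B)} := measure_mono hbad
    _ = 2 * (2⁻¹ * ν {z | 2⁻¹ ≤ ν (Prod.mk z ⁻¹' B)}) := by
        rw [← mul_assoc, ENNReal.mul_inv_cancel (by norm_num) (by norm_num), one_mul]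
    _ ≤ _ := by gcongr

/-- Identifies a sample of n pairs with a single sample of size 2n, the form to which the cover and
the measurability assumption apply. -/
theorem measurePreserving_append (P : Measure Z) [IsProbabilityMeasure P] (n : ℕ) :
    MeasurePreserving
      (fun w : Fin n → Z × Z => Fin.append (fun k => (w k).1) fun k => (w k).2)
      (Measure.pi fun _ => P.prod P) (Measure.pi fun _ : Fin (n + n) => P) := by
  have hmeas : Measurable
      fun w : Fin n → Z × Z => Fin.append (fun k => (w k).1) fun k => (w k).2 := by
    refine measurable_pi_lambda _ fun k => ?_
    refine Fin.addCases (fun k => ?_) (fun k => ?_) k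
    · simp only [Fin.append_left]; fun_prop
    · simp only [Fin.append_right]; fun_prop
  refine ⟨hmeas, (Measure.pi_eq fun s hs => ?_).symm⟩
  rw [Measure.map_apply hmeas (MeasurableSet.univ_pi hs)]
  have : (fun w : Fin n → Z × Z => Fin.append (fun k => (w k).1) fun k => (w k).2) ⁻¹'
      Set.univ.pi s = Set.univ.pi fun k => s (Fin.castAdd n k) ×ˢ s (Fin.natAdd n k) := by
    ext w
    simp only [Set.mem_preimage, Set.mem_univ_pi, Set.mem_prod, Fin.forall_fin_add,
      Fin.append_left, Fin.append_right, forall_and]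
  rw [this, Measure.pi_pi, Fin.prod_univ_add, ← Finset.prod_mul_distrib]
  simp only [Measure.prod_prod]

theorem measurePreserving_swapSigns (P : Measure Z) [IsProbabilityMeasure P] {n : ℕ}
    (s : Fin n → Bool) :
    MeasurePreserving (fun (w : Fin n → Z × Z) k => if s k then w k else (w k).swap)
      (Measure.pi fun _ => P.prod P) (Measure.pi fun _ => P.prod P) := by
  refine measurePreserving_pi (fun _ : Fin n => P.prod P) (fun _ => P.prod P)
    (f := fun k z => if s k then z else z.swap) fun k => ?_
  cases s k
  · simpa using Measure.measurePreserving_swap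
  · exact MeasurePreserving.id (P.prod P)

/-- Exchanging the members of the pairs with negative sign preserves the law and flips the
corresponding differences. The inequality suffices and holds for nonmeasurable events too. -/
theorem measure_prod_gap_le_signedGap (h : ι → Z → ℝ) (t : ℝ) {n : ℕ} (s : Fin n → Bool) :
    ((Measure.pi fun _ : Fin n => P).prod (Measure.pi fun _ : Fin n => P))
        {p | ∃ i, t < |(1 / (n : ℝ)) * ∑ k, (h i (p.1 k) - h i (p.2 k))|} ≤
      (Measure.pi fun _ : Fin n => P.prod P) (signedGap h t s) := by
  have h₁ := measurePreserving_arrowProdEquivProdArrow Z Z (Fin n) (fun _ => P) (fun _ => P)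
  rw [← h₁.measure_preimage_equiv]
  refine (measure_mono ?_).trans ((measurePreserving_swapSigns P s).measure_preimage_le _)
  rintro w ⟨i, hi⟩
  refine ⟨i, ?_⟩
  convert hi using 5 with k
  cases hk : s k
  · simp [boolLabel, hk, MeasurableEquiv.arrowProdEquivProdArrow, Equiv.arrowProdEquivProdArrow]
  · simp [boolLabel, hk, MeasurableEquiv.arrowProdEquivProdArrow, Equiv.arrowProdEquivProdArrow]

/-- The event is a superlevel set of a signed supremum over a sample of size 2n. It is needed to
interchange the sum over sign patterns with the integral. -/
theorem nullMeasurableSet_signedGap [Nonempty ι] {h : ι → Z → ℝ}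
    (hb : ∀ i z, h i z ∈ Set.Icc (0 : ℝ) 4) (hsup : MeasurableSuprema P h) {t : ℝ} {n : ℕ}
    (s : Fin n → Bool) :
    NullMeasurableSet (signedGap h t s) (Measure.pi fun _ : Fin n => P.prod P) := by
  -- Opposite signs on the second half produce the differences; averaging over 2n instead of n
  -- halves the threshold to t/2.
  let S : Fin (n + n) → Label :=
    Fin.append (fun k => boolLabel (s k)) fun k => boolLabel (!s k)
  have hS := (hsup.signed (n + n) S).comp_quasiMeasurePreserving
    (measurePreserving_append P n).quasiMeasurePreserving
  have heq : signedGap h t s = {w | t / 2 < ((fun z : Fin (n + n) → Z =>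
      ⨆ i, |(1 / ((n + n : ℕ) : ℝ)) * ∑ k, (S k : ℝ) * h i (z k)|) ∘
        fun w : Fin n → Z × Z => Fin.append (fun k => (w k).1) fun k => (w k).2) w} := by
    ext w
    have hbdd : BddAbove (Set.range fun i => |(1 / ((n + n : ℕ) : ℝ)) * ∑ k, (S k : ℝ) *
        h i ((Fin.append (fun k => (w k).1) fun k => (w k).2 : Fin (n + n) → Z) k)|) := by
      refine ⟨|1 / ((n + n : ℕ) : ℝ)| * ∑ _k : Fin (n + n), 4, ?_⟩
      rintro _ ⟨i, rfl⟩
      simp only [abs_mul]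
      refine mul_le_mul_of_nonneg_left ((Finset.abs_sum_le_sum_abs _ _).trans
        (Finset.sum_le_sum fun k _ => ?_)) (abs_nonneg _)
      rw [abs_mul]
      have h1 : |(S k : ℝ)| ≤ 1 := abs_le.mpr (label_mem_Icc (S k))
      have h2 : |h i ((Fin.append (fun k => (w k).1) fun k => (w k).2 : Fin (n + n) → Z) k)| ≤ 4 := by
        rw [abs_of_nonneg (hb _ _).1]; exact (hb _ _).2
      nlinarith [abs_nonneg (S k : ℝ)]
    simp only [Function.comp, Set.mem_ofPred_eq, signedGap]
    rw [lt_ciSup_iff hbdd]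
    refine exists_congr fun i => ?_
    rw [Fin.sum_univ_add]
    simp only [S, Fin.append_left, Fin.append_right]
    rw [← Finset.sum_add_distrib]
    have hrw : ∑ k, ((boolLabel (s k) : ℝ) * h i (w k).1 + (boolLabel (!s k) : ℝ) * h i (w k).2)
        = ∑ k, (boolLabel (s k) : ℝ) * (h i (w k).1 - h i (w k).2) := by
      refine Finset.sum_congr rfl fun k _ => ?_
      cases s k <;> simp [boolLabel] <;> ring
    rw [hrw]
    have h2 : (1 / ((n + n : ℕ) : ℝ)) = (1 / 2) * (1 / n) := by
      push_cast
      rw [← two_mul, one_div_mul_one_div]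
    rw [h2, mul_assoc, abs_mul (1 / 2 : ℝ), abs_of_pos (by norm_num : (0 : ℝ) < 1 / 2)]
    constructor <;> intro h <;> linarith
  rw [heq]
  exact nullMeasurableSet_lt aemeasurable_const hS

/-- The gap probability is bounded by that of every sign pattern, hence by their average. For a
fixed double sample, that average counts the few patterns of `card_signedGap_le`. -/
theorem measure_prod_gap_le [Nonempty ι] {h : ι → Z → ℝ}
    (hb : ∀ i z, h i z ∈ Set.Icc (0 : ℝ) 4) (hsup : MeasurableSuprema P h) {ε : ℝ} (hε : 0 < ε)
    {n N : ℕ} (hcov : ∀ z : Fin (n + n) → Z, ∃ T : Finset ι, T.card ≤ N ∧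
      ∀ i, ∃ j ∈ T, ∀ k, |h i (z k) - h j (z k)| ≤ ε / 8) :
    ((Measure.pi fun _ : Fin n => P).prod (Measure.pi fun _ : Fin n => P))
        {p | ∃ i, ε / 2 < |(1 / (n : ℝ)) * ∑ k, (h i (p.1 k) - h i (p.2 k))|} ≤
      ENNReal.ofReal (N * (2 * Real.exp (-(ε ^ 2 / 512 * n)))) := by
  classical
  set ρ := Measure.pi fun _ : Fin n => P.prod P
  set a := ((Measure.pi fun _ : Fin n => P).prod (Measure.pi fun _ : Fin n => P))
        {p | ∃ i, ε / 2 < |(1 / (n : ℝ)) * ∑ k, (h i (p.1 k) - h i (p.2 k))|}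
  have hnull := fun s : Fin n → Bool => nullMeasurableSet_signedGap (t := ε / 2) hb hsup s
  have hsum : (2 : ℝ≥0∞) ^ n * a ≤
      ENNReal.ofReal (N * (2 ^ n * (2 * Real.exp (-(ε ^ 2 / 512 * n))))) := by
    calc (2 : ℝ≥0∞) ^ n * a = ∑ _s : Fin n → Bool, a := by
          rw [Finset.sum_const, Finset.card_univ, Fintype.card_fun, Fintype.card_bool,
            Fintype.card_fin, nsmul_eq_mul]
          norm_num
      _ ≤ ∑ s : Fin n → Bool, ρ (signedGap h (ε / 2) s) :=
          Finset.sum_le_sum fun s _ => measure_prod_gap_le_signedGap h _ s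
      _ = ∑ s : Fin n → Bool, ∫⁻ w, (signedGap h (ε / 2) s).indicator 1 w ∂ρ :=
          Finset.sum_congr rfl fun s _ => (lintegral_indicator_one₀ (hnull s)).symm
      _ = ∫⁻ w, ∑ s : Fin n → Bool, (signedGap h (ε / 2) s).indicator 1 w ∂ρ :=
          (lintegral_finsetSum' _ fun s _ => aemeasurable_one.indicator₀ (hnull s)).symm
      _ ≤ ∫⁻ _w, ENNReal.ofReal (N * (2 ^ n * (2 * Real.exp (-(ε ^ 2 / 512 * n))))) ∂ρ := by
          refine lintegral_mono fun w => ?_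
          obtain ⟨T, hT, hTcov⟩ := hcov (Fin.append (fun k => (w k).1) fun k => (w k).2)
          have := card_signedGap_le hb hε w hT fun i => by
            obtain ⟨j, hj, hij⟩ := hTcov i
            refine ⟨j, hj, fun k => ⟨?_, ?_⟩⟩
            · simpa only [Fin.append_left] using hij (Fin.castAdd n k)
            · simpa only [Fin.append_right] using hij (Fin.natAdd n k)
          refine le_trans (le_of_eq ?_) (ENNReal.ofReal_le_ofReal this)
          rw [ENNReal.ofReal_natCast, Finset.card_filter]
          push_cast
          exact Finset.sum_congr rfl fun s _ => by simp [Set.indicator_apply]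
      _ = _ := by rw [lintegral_const, measure_univ, mul_one]
  have h2 : (2 : ℝ≥0∞) ^ n = ENNReal.ofReal (2 ^ n) := by
    rw [ENNReal.ofReal_pow two_pos.le, ENNReal.ofReal_ofNat]
  rw [mul_left_comm, ENNReal.ofReal_mul (by positivity), ← h2] at hsum
  exact (ENNReal.mul_le_mul_iff_right (by positivity) (by finiteness)).mp hsum

/-- The factor 4 combines symmetrization with the two tails, and n + n is the size of the double
sample. The summand 2 serves the small n, where the bound must only exceed 1. -/
theorem summable_polynomial_mul_exp (C D : ℕ) {r : ℝ} (hr : 0 < r) :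
    Summable fun n : ℕ =>
      (4 * (C * ((n + n : ℕ) + 1 : ℝ) ^ D) + 2) * Real.exp (-(r * n)) := by
  have h₁ := (Real.summable_pow_mul_exp_neg_nat_mul D hr).mul_left (4 * C * 3 ^ D : ℝ)
  have h₂ := (Real.summable_pow_mul_exp_neg_nat_mul 0 hr).mul_left (4 * C + 2 : ℝ)
  refine Summable.of_nonneg_of_le (fun n => by positivity) (fun n => ?_) (h₁.add h₂)
  have hpow : ((n + n : ℕ) + 1 : ℝ) ^ D ≤ 3 ^ D * n ^ D + 1 := by
    rcases Nat.eq_zero_or_pos n with rfl | hn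
    · norm_num
    · have : (1 : ℝ) ≤ n := by exact_mod_cast hn
      rw [← mul_pow]
      have : ((n + n : ℕ) + 1 : ℝ) ^ D ≤ (3 * n : ℝ) ^ D := by
        gcongr
        push_cast
        linarith
      linarith
  have hexp := Real.exp_pos (-r * n)
  rw [show -(r * n) = -r * n by ring, pow_zero, one_mul]
  have : (C : ℝ) * ((n + n : ℕ) + 1 : ℝ) ^ D ≤ C * (3 ^ D * n ^ D + 1) := by gcongr
  calc _ ≤ (4 * (C * (3 ^ D * n ^ D + 1)) + 2) * Real.exp (-r * n) := by gcongr
    _ = _ := by ring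

/-- The uniform law of large numbers for a bounded class with polynomial covers: the
probabilities of uniform deviations larger than `ε` are summable. -/
theorem tsum_measure_deviation_ne_top [Nonempty ι] {h : ι → Z → ℝ}
    (hm : ∀ i, Measurable (h i)) (hb : ∀ i z, h i z ∈ Set.Icc (0 : ℝ) 4)
    (hcov : HasPolynomialCovers h) (hsup : MeasurableSuprema P h) {ε : ℝ} (hε : 0 < ε) :
    ∑' n : ℕ, (Measure.pi fun _ : Fin n => P)
      {z | ∃ i, ε < |(1 / (n : ℝ)) * ∑ k, h i (z k) - ∫ w, h i w ∂P|} ≠ ⊤ := by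
  obtain ⟨C, D, hCD⟩ := hcov (ε / 8) (by positivity)
  have hsummable := summable_polynomial_mul_exp C D (r := ε ^ 2 / 512) (by positivity)
  refine ne_top_of_le_ne_top hsummable.tsum_ofReal_ne_top (ENNReal.tsum_le_tsum fun n => ?_)
  have hx : 0 ≤ ε ^ 2 / 512 * (n : ℝ) := by positivity
  rcases le_or_gt 32 (n * ε ^ 2) with hn | hn
  · refine (measure_deviation_le_two_mul hm hb hε hn).trans ?_
    have := measure_prod_gap_le hb hsup hε (hCD (n + n))
    calc _ ≤ 2 * ENNReal.ofReal _ := by gcongr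
      _ = ENNReal.ofReal (2 * (((C * (n + n + 1) ^ D : ℕ) : ℝ) *
          (2 * Real.exp (-(ε ^ 2 / 512 * n))))) := by
          rw [ENNReal.ofReal_mul two_pos.le, ENNReal.ofReal_ofNat]
      _ ≤ _ := by
          refine ENNReal.ofReal_le_ofReal ?_
          push_cast
          nlinarith [Real.exp_pos (-(ε ^ 2 / 512 * n))]
  -- Here nε² < 32, so the exponential is at least 1 - 1/16 ≥ 1/2, and twice it is at least 1.
  · refine prob_le_one.trans ?_
    rw [← ENNReal.ofReal_one]
    refine ENNReal.ofReal_le_ofReal ?_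
    have h1 := Real.add_one_le_exp (-(ε ^ 2 / 512 * (n : ℝ)))
    have h2 : (1 : ℝ) / 2 ≤ Real.exp (-(ε ^ 2 / 512 * n)) := by nlinarith
    have h3 : (0 : ℝ) ≤ 4 * (C * ((n + n : ℕ) + 1 : ℝ) ^ D) := by positivity
    nlinarith

end UniformLaw

/-! ### The law of an observation in terms of the regression function -/

theorem measurable_signLabel : Measurable signLabel :=
  Measurable.ite measurableSet_Ici measurable_const measurable_const

instance : IsProbabilityMeasure uniformLaw :=
  cond_isProbabilityMeasure_of_finite (by rw [Real.volume_Icc]; norm_num)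
    (by rw [Real.volume_Icc]; finiteness)

theorem signLabel_mem_Icc (t : ℝ) : (signLabel t : ℝ) ∈ Set.Icc (-1 : ℝ) 1 :=
  label_mem_Icc _

theorem label_sq (y : Label) : (y : ℝ) ^ 2 = 1 := by
  obtain ⟨y, rfl | rfl⟩ := y <;> norm_num

theorem integrable_of_mem_Icc {Z : Type*} [MeasurableSpace Z] {P : Measure Z} [IsFiniteMeasure P]
    {g : Z → ℝ} (hg : Measurable g) {a b : ℝ} (h : ∀ z, g z ∈ Set.Icc a b) : Integrable g P :=
  Integrable.of_mem_Icc a b hg.aemeasurable (ae_of_all _ h)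

theorem measurable_coe_signLabel_add (t : ℝ) : Measurable fun u => (signLabel (t + u) : ℝ) :=
  measurable_subtype_coe.comp (measurable_signLabel.comp (measurable_const_add t))

theorem integral_signLabel {t : ℝ} (ht : t ∈ Set.Icc (-1 : ℝ) 1) :
    ∫ u, (signLabel (t + u) : ℝ) ∂uniformLaw = t := by
  -- The label is twice the indicator of u ≥ -t, minus one, and that event has probability (1 +
  -- t)/2.
  have hform : (fun u => (signLabel (t + u) : ℝ)) =
      fun u => (Set.Ici (-t)).indicator (fun _ => (2 : ℝ)) u - 1 := by
    funext u
    by_cases h : 0 ≤ t + u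
    · rw [Set.indicator_of_mem (by simp only [Set.mem_Ici]; linarith)]
      simp only [signLabel, h, if_true]
      norm_num
    · rw [Set.indicator_of_notMem (by simp only [Set.mem_Ici]; linarith)]
      simp only [signLabel, h, if_false]
      norm_num
  have hmeas : uniformLaw.real (Set.Ici (-t)) = (1 + t) / 2 := by
    have hinter : Set.Icc (-1 : ℝ) 1 ∩ Set.Ici (-t) = Set.Icc (-t) 1 := by
      ext u
      simp only [Set.mem_inter_iff, Set.mem_Icc, Set.mem_Ici]
      constructor
      · rintro ⟨⟨-, h⟩, h'⟩; exact ⟨h', h⟩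
      · rintro ⟨h', h⟩; exact ⟨⟨by linarith [ht.2], h⟩, h'⟩
    rw [uniformLaw, Measure.real, cond_apply measurableSet_Icc, hinter, Real.volume_Icc,
      Real.volume_Icc, ENNReal.toReal_mul, ENNReal.toReal_inv, ENNReal.toReal_ofReal (by norm_num),
      ENNReal.toReal_ofReal (by linarith [ht.1])]
    ring
  rw [hform, integral_sub ((integrable_const _).indicator measurableSet_Ici) (integrable_const _),
    integral_indicator_const _ measurableSet_Ici, hmeas]
  simp

theorem integral_sq_sub_signLabel (a : ℝ) {t : ℝ} (ht : t ∈ Set.Icc (-1 : ℝ) 1) :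
    ∫ u, (a - (signLabel (t + u) : ℝ)) ^ 2 ∂uniformLaw = (a - t) ^ 2 + (1 - t ^ 2) := by
  have hform : (fun u => (a - (signLabel (t + u) : ℝ)) ^ 2) =
      fun u => (a ^ 2 + 1) - 2 * a * (signLabel (t + u) : ℝ) := by
    funext u
    have := label_sq (signLabel (t + u))
    linear_combination this
  have hint : Integrable (fun u => (signLabel (t + u) : ℝ)) uniformLaw :=
    integrable_of_mem_Icc (measurable_coe_signLabel_add t) fun u => signLabel_mem_Icc _
  rw [hform, integral_sub (integrable_const _) (hint.const_mul _), integral_const_mul,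
    integral_signLabel ht]
  simp
  ring

section Law

variable {X : Type*} [MeasurableSpace X]

/-- The two identities form an invertible linear system for the masses of the two labels over B. -/
theorem setIntegral_label (Q : Measure (X × Label)) [IsProbabilityMeasure Q] {B : Set X}
    (hB : MeasurableSet B) :
    ∫ p in B ×ˢ Set.univ, (p.2 : ℝ) ∂Q =
      Q.real (B ×ˢ {⟨1, Or.inl rfl⟩}) - Q.real (B ×ˢ {⟨-1, Or.inr rfl⟩}) ∧
    Q.real (B ×ˢ Set.univ) =
      Q.real (B ×ˢ {⟨1, Or.inl rfl⟩}) + Q.real (B ×ˢ {⟨-1, Or.inr rfl⟩}) := by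
  have huniv : (Set.univ : Set Label) = {⟨1, Or.inl rfl⟩} ∪ {⟨-1, Or.inr rfl⟩} := by
    ext ⟨y, hy⟩
    simpa [or_comm] using hy
  have hdisj : Disjoint (B ×ˢ {(⟨1, Or.inl rfl⟩ : Label)}) (B ×ˢ {(⟨-1, Or.inr rfl⟩ : Label)}) := by
    rw [Set.disjoint_prod]
    right
    norm_num
  have h₁ := hB.prod (measurableSet_singleton (⟨1, Or.inl rfl⟩ : Label))
  have h₂ := hB.prod (measurableSet_singleton (⟨-1, Or.inr rfl⟩ : Label))
  have hint : Integrable (fun p : X × Label => (p.2 : ℝ)) Q :=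
    integrable_of_mem_Icc (measurable_subtype_coe.comp measurable_snd) fun p => label_mem_Icc _
  rw [huniv, Set.prod_union]
  refine ⟨?_, measureReal_union hdisj h₂⟩
  rw [setIntegral_union hdisj h₂ hint.integrableOn hint.integrableOn,
    setIntegral_congr_fun (g := fun _ => (1 : ℝ)) h₁ (by rintro ⟨x, y⟩ ⟨-, rfl⟩; rfl),
    setIntegral_congr_fun (g := fun _ => (-1 : ℝ)) h₂ (by rintro ⟨x, y⟩ ⟨-, rfl⟩; rfl)]
  simp [sub_eq_add_neg]

/-- The law of a labelled observation is determined by the input marginal and the conditional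
expectation of the label. -/
theorem measure_ext_label {Q Q' : Measure (X × Label)} [IsProbabilityMeasure Q]
    [IsProbabilityMeasure Q'] (h₁ : Q.fst = Q'.fst)
    (h₂ : ∀ B : Set X, MeasurableSet B →
      ∫ p in B ×ˢ Set.univ, (p.2 : ℝ) ∂Q = ∫ p in B ×ˢ Set.univ, (p.2 : ℝ) ∂Q') : Q = Q' := by
  have hrect : ∀ B : Set X, MeasurableSet B → ∀ y : Label, Q (B ×ˢ {y}) = Q' (B ×ˢ {y}) := by
    intro B hB y
    obtain ⟨e₁, e₂⟩ := setIntegral_label Q hB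
    obtain ⟨e₁', e₂'⟩ := setIntegral_label Q' hB
    have e₃ := h₂ B hB
    have e₄ : Q.real (B ×ˢ Set.univ) = Q'.real (B ×ˢ Set.univ) := by
      rw [Measure.real, Measure.real, Set.prod_univ, ← Measure.fst_apply hB, h₁,
        Measure.fst_apply hB]
    rw [← measureReal_eq_measureReal_iff]
    obtain ⟨y, rfl | rfl⟩ := y <;> linarith
  ext E hE
  have hsplit : E = ((fun x => (x, (⟨1, Or.inl rfl⟩ : Label))) ⁻¹' E) ×ˢ {⟨1, Or.inl rfl⟩} ∪
      ((fun x => (x, (⟨-1, Or.inr rfl⟩ : Label))) ⁻¹' E) ×ˢ {⟨-1, Or.inr rfl⟩} := by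
    ext ⟨x, y, hy⟩
    rcases hy with rfl | rfl
    · simpa using fun _ h => by norm_num at h
    · simpa using fun _ h => by norm_num at h
  have hm₁ : MeasurableSet ((fun x : X => (x, (⟨1, Or.inl rfl⟩ : Label))) ⁻¹' E) :=
    measurable_prodMk_right hE
  have hm₂ : MeasurableSet ((fun x : X => (x, (⟨-1, Or.inr rfl⟩ : Label))) ⁻¹' E) :=
    measurable_prodMk_right hE
  have hdisj : ∀ B C : Set X,
      Disjoint (B ×ˢ {(⟨1, Or.inl rfl⟩ : Label)}) (C ×ˢ {(⟨-1, Or.inr rfl⟩ : Label)}) := by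
    intro B C
    rw [Set.disjoint_prod]
    right
    norm_num
  rw [hsplit, measure_union (hdisj _ _) (hm₂.prod (measurableSet_singleton _)),
    measure_union (hdisj _ _) (hm₂.prod (measurableSet_singleton _)), hrect _ hm₁, hrect _ hm₂]

/-- The observation with input `x` and label `sign (g x + u)`. -/
noncomputable def labelled (g : X → ℝ) (p : X × ℝ) : X × Label := (p.1, signLabel (g p.1 + p.2))

theorem measurable_labelled {g : X → ℝ} (hg : Measurable g) : Measurable (labelled g) :=
  measurable_fst.prodMk (measurable_signLabel.comp (by fun_prop))

/-- A binary label is determined in law by its conditional mean, and the threshold label has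
conditional mean g x. This makes the original sample exchangeable with the alternatives. -/
theorem map_labelled_eq {Q : Measure (X × Label)} [IsProbabilityMeasure Q] {g : X → ℝ}
    (hreg : IsRegressionFunction Q g) (hg : ∀ x, g x ∈ Set.Icc (-1 : ℝ) 1) :
    (Q.fst.prod uniformLaw).map (labelled g) = Q := by
  have hl := measurable_labelled hreg.1
  have : IsProbabilityMeasure ((Q.fst.prod uniformLaw).map (labelled g)) :=
    Measure.isProbabilityMeasure_map hl.aemeasurable
  have hY : Measurable fun p : X × Label => (p.2 : ℝ) := measurable_subtype_coe.comp measurable_snd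
  have hYint : Integrable (fun p : X × Label => (p.2 : ℝ)) Q :=
    integrable_of_mem_Icc hY fun p => label_mem_Icc _
  refine measure_ext_label ?_ fun B hB => ?_
  · rw [Measure.fst, Measure.map_map measurable_fst hl]
    exact Measure.fst_prod
  · have hBm : MeasurableSet (B ×ˢ (Set.univ : Set Label)) := hB.prod MeasurableSet.univ
    have hleft : ∫ p in B ×ˢ Set.univ, (p.2 : ℝ) ∂((Q.fst.prod uniformLaw).map (labelled g))
        = ∫ x in B, g x ∂Q.fst := by
      rw [setIntegral_map hBm hY.aestronglyMeasurable hl.aemeasurable]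
      have hpre : labelled g ⁻¹' (B ×ˢ Set.univ) = B ×ˢ Set.univ := by
        ext p
        simp [labelled]
      rw [hpre, setIntegral_prod]
      · refine setIntegral_congr_fun hB fun x _ => ?_
        simp only [labelled, Measure.restrict_univ]
        exact integral_signLabel (hg x)
      · exact (integrable_of_mem_Icc (hY.comp hl) fun p => signLabel_mem_Icc _).integrableOn
    have hright : ∫ p in B ×ˢ Set.univ, (p.2 : ℝ) ∂Q = ∫ x in B, g x ∂Q.fst := by
      have hBc : MeasurableSet[MeasurableSpace.comap (Prod.fst : X × Label → X) inferInstance]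
          (B ×ˢ (Set.univ : Set Label)) := ⟨B, hB, Set.prod_univ.symm⟩
      rw [← setIntegral_condExp measurable_fst.comap_le hYint hBc,
        setIntegral_congr_ae hBm (hreg.2.mono fun p hp _ => hp), Set.prod_univ, Measure.fst,
        setIntegral_map hB hreg.1.aestronglyMeasurable measurable_fst.aemeasurable]
    rw [hleft, hright]

/-- Bias–variance decomposition: given x, the label has mean h x and square 1. The last term is free
of g, so the risk is least at g = h. -/
theorem integral_resampledLoss (ν : Measure X) [IsProbabilityMeasure ν] {g h : X → ℝ}
    (hgm : Measurable g) (hhm : Measurable h) (hg : ∀ x, g x ∈ Set.Icc (-1 : ℝ) 1)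
    (hh : ∀ x, h x ∈ Set.Icc (-1 : ℝ) 1) :
    ∫ p : X × ℝ, (g p.1 - (signLabel (h p.1 + p.2) : ℝ)) ^ 2 ∂(ν.prod uniformLaw) =
      ∫ x, (g x - h x) ^ 2 ∂ν + ∫ x, (1 - h x ^ 2) ∂ν := by
  have hY : Measurable fun p : X × ℝ => (signLabel (h p.1 + p.2) : ℝ) :=
    measurable_subtype_coe.comp (measurable_snd.comp (measurable_labelled hhm))
  rw [integral_prod, ← integral_add]
  · exact integral_congr_ae (ae_of_all _ fun x => integral_sq_sub_signLabel (g x) (hh x))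
  · refine integrable_of_mem_Icc (a := 0) (b := 4) (by fun_prop) fun x => ⟨sq_nonneg _, ?_⟩
    nlinarith [(hg x).1, (hg x).2, (hh x).1, (hh x).2]
  · refine integrable_of_mem_Icc (a := 0) (b := 1) (by fun_prop) fun x => ⟨?_, ?_⟩ <;>
      nlinarith [(hh x).1, (hh x).2]
  · refine integrable_of_mem_Icc (a := 0) (b := 4) (by fun_prop) fun p => ⟨sq_nonneg _, ?_⟩
    have := signLabel_mem_Icc (h p.1 + p.2)
    nlinarith [(hg p.1).1, (hg p.1).2, this.1, this.2]

/-- Labelling an i.i.d. sample of inputs gives an i.i.d. sample of observations. -/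
theorem measurePreserving_labelled_sample {Q : Measure (X × Label)} [IsProbabilityMeasure Q]
    {g : X → ℝ} (hreg : IsRegressionFunction Q g) (hg : ∀ x, g x ∈ Set.Icc (-1 : ℝ) 1) (n : ℕ) :
    MeasurePreserving (fun (p : (Fin n → X) × (Fin n → ℝ)) i => labelled g (p.1 i, p.2 i))
      ((Measure.pi fun _ => Q.fst).prod (Measure.pi fun _ => uniformLaw))
      (Measure.pi fun _ => Q) := by
  have h₁ := (measurePreserving_arrowProdEquivProdArrow X ℝ (Fin n) (fun _ => Q.fst)
    (fun _ => uniformLaw)).symm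
  have h₂ := measurePreserving_pi (fun _ : Fin n => Q.fst.prod uniformLaw) (fun _ => Q)
    (f := fun _ => labelled g) fun _ => ⟨measurable_labelled hreg.1, map_labelled_eq hreg hg⟩
  exact h₂.comp h₁

end Law

/-! ### The exact level of the confidence region -/

/-- In a finite linear order exactly `q` elements have fewer than `q` predecessors. -/
theorem card_rank_lt {m : ℕ} {α : Type*} [LinearOrder α] {b : Fin m → α}
    (hb : Function.Injective b) {q : ℕ} (hq : q ≤ m) :
    (Finset.univ.filter fun c => (Finset.univ.filter fun j => b j < b c).card < q).card = q := by
  have hlt : ∀ c, (Finset.univ.filter fun j => b j < b c).card < m := fun c => by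
    have := Finset.card_lt_card (Finset.filter_ssubset (p := fun j => b j < b c).mpr
      ⟨c, Finset.mem_univ c, lt_irrefl (b c)⟩)
    simpa using this
  let r : Fin m → Fin m := fun c => ⟨_, hlt c⟩
  have hmono : ∀ c c', b c < b c' → r c < r c' := fun c c' h => by
    refine Fin.mk_lt_mk.mpr (Finset.card_lt_card ?_)
    rw [Finset.ssubset_iff_of_subset fun j hj => ?_]
    · exact ⟨c, by simpa using h, by simp⟩
    · simp only [Finset.mem_filter, Finset.mem_univ, true_and] at hj ⊢
      exact hj.trans h
  -- The number of predecessors is strictly increasing along the order, hence injective from a set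
  -- of size m into {0, …, m - 1}.
  have hr : Function.Bijective r := by
    refine Finite.injective_iff_bijective.mp fun c c' h => hb ?_
    rcases lt_trichotomy (b c) (b c') with hlt | heq | hlt
    · exact absurd h (hmono _ _ hlt).ne
    · exact heq
    · exact absurd h (hmono _ _ hlt).ne'
  calc _ = (Finset.univ.filter fun i : Fin m => (i : ℕ) < q).card :=
        Finset.card_bijective r hr fun c => by simp [r]
    _ = q := by
        rw [Fin.card_filter_val_lt, min_eq_right hq]

theorem tagLT_iff {m : ℕ} (a b : ℝ × Fin m) : TagLT a b ↔ toLex a < toLex b :=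
  Prod.Lex.lt_iff.symm

section Exchangeability

/-- The rank of the `c`-th among finitely many tagged numbers. -/
noncomputable def tagRank {m : ℕ} (a : Fin m → ℝ) (σ : Equiv.Perm (Fin m)) (c : Fin m) : ℕ :=
  open Classical in 1 + (Finset.univ.filter fun j => TagLT (a j, σ j) (a c, σ c)).card

theorem card_tagRank_le {m : ℕ} (a : Fin m → ℝ) (σ : Equiv.Perm (Fin m)) {q : ℕ} (hq : q ≤ m) :
    (Finset.univ.filter fun c => tagRank a σ c ≤ q).card = q := by
  classical
  have hinj : Function.Injective fun j => toLex (a j, σ j) := fun i j h =>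
    σ.injective (Prod.ext_iff.mp (toLex.injective h)).2
  rw [← card_rank_lt hinj hq]
  congr 1
  ext c
  simp only [Finset.mem_filter, Finset.mem_univ, true_and, tagRank, tagLT_iff]
  rw [card_rank_lt hinj hq, Nat.add_comm, Nat.add_one_le_iff]

/-- τ maps the predecessors on one side bijectively onto those on the other. With τ a swap,
invariance of the joint law makes all ranks equally distributed. -/
theorem tagRank_comp {m : ℕ} (a : Fin m → ℝ) (σ τ : Equiv.Perm (Fin m)) (c : Fin m) :
    tagRank (a ∘ τ) (σ * τ) c = tagRank a σ (τ c) := by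
  classical
  unfold tagRank
  congr 1
  exact Finset.card_bijective τ τ.bijective fun j => by
    rw [Finset.mem_filter, Finset.mem_filter]
    exact and_congr (by simp) Iff.rfl

instance (m : ℕ) : DiscreteMeasurableSpace (Equiv.Perm (Fin m)) := ⟨fun _ => trivial⟩

theorem measurableSet_tagRank_le {m : ℕ} (c : Fin m) (q : ℕ) :
    MeasurableSet {p : (Fin m → ℝ) × Equiv.Perm (Fin m) | tagRank p.1 p.2 c ≤ q} := by
  classical
  have htag : ∀ j, MeasurableSet {p : (Fin m → ℝ) × Equiv.Perm (Fin m) | p.2 j < p.2 c} :=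
    fun j => measurable_snd (MeasurableSet.of_discrete (s := {σ : Equiv.Perm (Fin m) | σ j < σ c}))
  have hval : ∀ j, Measurable fun p : (Fin m → ℝ) × Equiv.Perm (Fin m) => p.1 j := fun j =>
    (measurable_pi_apply j).comp measurable_fst
  have hmeas : Measurable fun p : (Fin m → ℝ) × Equiv.Perm (Fin m) => tagRank p.1 p.2 c := by
    simp only [tagRank, Finset.card_filter]
    refine measurable_const.add (Finset.measurable_fun_sum _ fun j _ => ?_)
    refine Measurable.ite ?_ measurable_const measurable_const
    exact (measurableSet_lt (hval j) (hval c)).union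
      ((measurableSet_eq_fun (hval j) (hval c)).inter (htag j))
  exact measurableSet_le hmeas measurable_const

/-- Among exchangeable real variables with random tie-breaking, the rank is uniform. -/
theorem prod_tagRank_le {A B : Type*} [MeasurableSpace A] [MeasurableSpace B] {m : ℕ}
    (ξ : Measure A) [IsProbabilityMeasure ξ] (ν : Measure B) [IsProbabilityMeasure ν]
    (κ : Measure (Equiv.Perm (Fin m))) [IsProbabilityMeasure κ] {r : ℝ≥0∞}
    (hκ : ∀ σ, κ {σ} = r) {ζ : A × B → ℝ} (hζ : Measurable ζ) {q : ℕ} (hq : q ≤ m) (c : Fin m) :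
    ((ξ.prod (Measure.pi fun _ : Fin m => ν)).prod κ)
      {p | tagRank (fun j => ζ (p.1.1, p.1.2 j)) p.2 c ≤ q} = (q : ℝ≥0∞) / m := by
  classical
  set ρ := (ξ.prod (Measure.pi fun _ : Fin m => ν)).prod κ
  set E : Fin m → Set ((A × (Fin m → B)) × Equiv.Perm (Fin m)) :=
    fun c => {p | tagRank (fun j => ζ (p.1.1, p.1.2 j)) p.2 c ≤ q}
  have hE : ∀ c, MeasurableSet (E c) := fun c => by
    have : Measurable fun p : (A × (Fin m → B)) × Equiv.Perm (Fin m) =>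
        ((fun j => ζ (p.1.1, p.1.2 j)), p.2) := by fun_prop
    exact this (measurableSet_tagRank_le c q)
  -- Values and tags are swapped together: the first swap preserves the product law, the second
  -- preserves κ because all its atoms have equal mass.
  have hinv : ∀ c', ρ (E c') = ρ (E c) := fun c' => by
    set τ := Equiv.swap c c'
    have hV : MeasurePreserving (fun V : Fin m → B => V ∘ τ) (Measure.pi fun _ => ν)
        (Measure.pi fun _ => ν) := by
      have := measurePreserving_piCongrLeft (fun _ : Fin m => ν) τ.symm
      convert this using 1
      funext V j
      simp [MeasurableEquiv.piCongrLeft, Equiv.piCongrLeft, Equiv.piCongrLeft']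
    have hσ : MeasurePreserving (fun σ : Equiv.Perm (Fin m) => σ * τ) κ κ := by
      refine ⟨Measurable.of_discrete, Measure.ext_of_singleton fun σ => ?_⟩
      rw [Measure.map_apply Measurable.of_discrete (measurableSet_singleton _)]
      have : (fun σ : Equiv.Perm (Fin m) => σ * τ) ⁻¹' {σ} = {σ * τ⁻¹} := by
        ext σ'
        simp [eq_mul_inv_iff_mul_eq]
      rw [this, hκ, hκ]
    have hΦ := ((MeasurePreserving.id ξ).prod hV).prod hσ
    rw [← hΦ.measure_preimage (hE c).nullMeasurableSet]
    congr 1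
    ext p
    have := tagRank_comp (fun j => ζ (p.1.1, p.1.2 j)) p.2 τ c
    rw [Equiv.swap_apply_left] at this
    simp only [E, Set.mem_ofPred_eq, ← this]
    rfl
  -- The expected number of indices with rank at most q, a number that is identically q.
  have hsum : (m : ℝ≥0∞) * ρ (E c) = q := by
    calc (m : ℝ≥0∞) * ρ (E c) = ∑ c', ρ (E c') := by simp [hinv]
      _ = ∑ c', ∫⁻ p, (E c').indicator 1 p ∂ρ :=
          Finset.sum_congr rfl fun c' _ => (lintegral_indicator_one (hE c')).symm
      _ = ∫⁻ p, ∑ c', (E c').indicator 1 p ∂ρ :=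
          (lintegral_finsetSum _ fun c' _ => measurable_one.indicator (hE c')).symm
      _ = ∫⁻ _p, (q : ℝ≥0∞) ∂ρ := by
          refine lintegral_congr fun p => ?_
          have := card_tagRank_le (fun j => ζ (p.1.1, p.1.2 j)) p.2 hq
          rw [Finset.card_filter] at this
          rw [← this]
          push_cast
          exact Finset.sum_congr rfl fun c' _ => by simp [Set.indicator_apply, E]
      _ = q := by rw [lintegral_const, measure_univ, mul_one]
  have hm : (m : ℝ≥0∞) ≠ 0 := by
    have : 0 < m := c.pos
    exact_mod_cast this.ne'
  rw [ENNReal.eq_div_iff hm (by finiteness), hsum]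

end Exchangeability

theorem rankStat_succ {X : Type*} {k n : ℕ} (fhat : (n : ℕ) → (Fin n → X × Label) → X → ℝ)
    (g : X → ℝ) (x : Fin n → X) (V : Fin (k + 1) → Fin n → ℝ) (σ : Equiv.Perm (Fin (k + 1))) :
    rankStat fhat g (fun i => labelled g (x i, V (Fin.last k) i)) (fun j : Fin k => V j.castSucc) σ =
      tagRank (fun j => refVar fhat g fun i => labelled g (x i, V j i)) σ (Fin.last k) := by
  classical
  unfold rankStat tagRank
  -- The last index stands for the original sample; it never precedes itself, so its term vanishes.
  rw [Finset.card_filter, Fin.sum_univ_castSucc, if_neg (by simp [tagLT_iff]), add_zero]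
  congr 1

theorem measurable_refVar {X : Type*} [MeasurableSpace X]
    {fhat : (n : ℕ) → (Fin n → X × Label) → X → ℝ}
    (hf : ∀ n, Measurable fun p : (Fin n → X × Label) × X => fhat n p.1 p.2)
    {g : X → ℝ} (hg : Measurable g) (n : ℕ) :
    Measurable fun D : Fin n → X × Label => refVar fhat g D := by
  unfold refVar
  refine measurable_const.mul (Finset.measurable_fun_sum _ fun i _ => ?_)
  have h : Measurable fun D : Fin n → X × Label => (D, (D i).1) := by fun_prop
  exact ((hg.comp (by fun_prop)).sub ((hf n).comp h)).pow_const 2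

theorem measurableSet_rankStat_le {X : Type*} [MeasurableSpace X] {m : ℕ} [NeZero m]
    {fhat : (n : ℕ) → (Fin n → X × Label) → X → ℝ}
    (hf : ∀ n, Measurable fun p : (Fin n → X × Label) × X => fhat n p.1 p.2)
    {g : X → ℝ} (hg : Measurable g) (n q : ℕ) :
    MeasurableSet {p : ((Fin n → X × Label) × (Fin (m - 1) → Fin n → ℝ)) × Equiv.Perm (Fin m) |
      rankStat fhat g p.1.1 p.1.2 p.2 ≤ q} := by
  classical
  have htag : ∀ i j, MeasurableSet {p : ((Fin n → X × Label) × (Fin (m - 1) → Fin n → ℝ)) ×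
      Equiv.Perm (Fin m) | p.2 i < p.2 j} := fun i j =>
    measurable_snd (MeasurableSet.of_discrete (s := {σ : Equiv.Perm (Fin m) | σ i < σ j}))
  have h₀ : Measurable fun p : ((Fin n → X × Label) × (Fin (m - 1) → Fin n → ℝ)) ×
      Equiv.Perm (Fin m) => refVar fhat g p.1.1 :=
    (measurable_refVar hf hg n).comp (measurable_fst.comp measurable_fst)
  have h₁ : ∀ j, Measurable fun p : ((Fin n → X × Label) × (Fin (m - 1) → Fin n → ℝ)) ×
      Equiv.Perm (Fin m) => refVar fhat g (resample g p.1.1 (p.1.2 j)) := fun j => by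
    refine (measurable_refVar hf hg n).comp (measurable_pi_lambda _ fun i => ?_)
    exact (measurable_labelled hg).comp (f := fun p : ((Fin n → X × Label) ×
      (Fin (m - 1) → Fin n → ℝ)) × Equiv.Perm (Fin m) => ((p.1.1 i).1, p.1.2 j i)) (by fun_prop)
  unfold rankStat
  refine measurableSet_le (measurable_const.add (Finset.measurable_fun_sum _ fun j _ => ?_))
    measurable_const
  refine Measurable.ite ?_ measurable_const measurable_const
  exact (measurableSet_lt (h₁ j) h₀).union
    ((measurableSet_eq_fun (h₁ j) h₀).inter (htag _ _))

/-! ### The coverage probability -/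

section Sample

variable {Ω X : Type*} [MeasurableSpace Ω] [MeasurableSpace X] {μ : Measure Ω}
  {Q : Measure (X × Label)}
  {S : ℕ → Ω → X × Label}

theorem IsIIDSample.measurable_sample (hS : IsIIDSample μ Q S) (n : ℕ) :
    Measurable fun ω (i : Fin n) => S i ω :=
  measurable_pi_lambda _ fun i => hS.measurable i

theorem IsIIDSample.map_sample [IsProbabilityMeasure μ] (hS : IsIIDSample μ Q S) (n : ℕ) :
    μ.map (fun ω (i : Fin n) => S i ω) = Measure.pi fun _ => Q := by
  have h : iIndepFun (fun i : Fin n => S i) μ := hS.indep.precomp Fin.val_injective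
  rw [(iIndepFun_iff_map_fun_eq_pi_map fun i => (hS.measurable _).aemeasurable).mp h]
  simp only [hS.law]

theorem IsStemSample.map_sample_prod [IsProbabilityMeasure μ] {m : ℕ}
    {U : (n : ℕ) → Ω → Fin (m - 1) → Fin n → ℝ}
    {π : (n : ℕ) → Ω → Equiv.Perm (Fin m)} (hS : IsIIDSample μ Q S)
    (hstem : IsStemSample m μ S U π) (n : ℕ) :
    μ.map (fun ω => ((fun i : Fin n => S i ω), U n ω)) =
      (Measure.pi fun _ => Q).prod (Measure.pi fun _ => Measure.pi fun _ => uniformLaw) := by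
  rw [(indepFun_iff_map_prod_eq_prod_map_map (hS.measurable_sample n).aemeasurable
    (hstem.measurable_U n).aemeasurable).mp (hstem.indep_U n), hS.map_sample, hstem.law_U]

/-- The confidence region covers the true parameter with probability exactly `q / m`. -/
theorem measure_rankStat_le [IsProbabilityMeasure μ] [IsProbabilityMeasure Q]
    (hS : IsIIDSample μ Q S) {g : X → ℝ}
    (hreg : IsRegressionFunction Q g) (hg : ∀ x, g x ∈ Set.Icc (-1 : ℝ) 1)
    {fhat : (n : ℕ) → (Fin n → X × Label) → X → ℝ}
    (hf : ∀ n, Measurable fun p : (Fin n → X × Label) × X => fhat n p.1 p.2)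
    {m : ℕ} [NeZero m] {q : ℕ} (hq : q ≤ m)
    {U : (n : ℕ) → Ω → Fin (m - 1) → Fin n → ℝ} {π : (n : ℕ) → Ω → Equiv.Perm (Fin m)}
    (hstem : IsStemSample m μ S U π) (n : ℕ) :
    μ {ω | rankStat fhat g (fun i : Fin n => S i ω) (U n ω) (π n ω) ≤ q} =
      (q : ℝ≥0∞) / (m : ℝ≥0∞) := by
  obtain ⟨k, rfl⟩ := Nat.exists_eq_succ_of_ne_zero (NeZero.ne m)
  set κ := μ.map (π n)
  have : IsProbabilityMeasure κ :=
    Measure.isProbabilityMeasure_map (hstem.measurable_π n).aemeasurable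
  have hκ : ∀ σ, κ {σ} = (((k + 1).factorial : ℕ) : ℝ≥0∞)⁻¹ := fun σ => by
    rw [Measure.map_apply (hstem.measurable_π n) (measurableSet_singleton _)]
    exact hstem.law_π n σ
  have hmeas := (hS.measurable_sample n).prodMk (hstem.measurable_U n)
  have hlaw : MeasurePreserving
      (fun ω => (((fun i : Fin n => S i ω), U n ω), π n ω)) μ
      (((Measure.pi fun _ => Q).prod
        (Measure.pi fun _ => Measure.pi fun _ => uniformLaw)).prod κ) := by
    refine ⟨hmeas.prodMk (hstem.measurable_π n), ?_⟩
    rw [(indepFun_iff_map_prod_eq_prod_map_map hmeas.aemeasurable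
      (hstem.measurable_π n).aemeasurable).mp (hstem.indep_π n), hstem.map_sample_prod hS]
  have hE := measurableSet_rankStat_le (m := k + 1) hf hreg.1 n q
  -- The last of k + 1 independent rows of uniform variables labels the inputs and yields the
  -- original sample; the other k rows remain for the alternatives.
  have hsplit : MeasurePreserving
      (fun p : (Fin n → X) × (Fin (k + 1) → Fin n → ℝ) =>
        ((fun i => labelled g (p.1 i, p.2 (Fin.last k) i)), fun j : Fin k => p.2 j.castSucc))
      ((Measure.pi fun _ => Q.fst).prod (Measure.pi fun _ => Measure.pi fun _ => uniformLaw))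
      ((Measure.pi fun _ => Q).prod (Measure.pi fun _ => Measure.pi fun _ => uniformLaw)) := by
    have h₁ := measurePreserving_piFinSuccAbove
      (fun _ : Fin (k + 1) => Measure.pi fun _ : Fin n => uniformLaw) (Fin.last k)
    have h₂ := (MeasurePreserving.id (Measure.pi fun _ : Fin n => Q.fst)).prod h₁
    have h₃ := (measurePreserving_prodAssoc (Measure.pi fun _ : Fin n => Q.fst)
      (Measure.pi fun _ : Fin n => uniformLaw)
      (Measure.pi fun _ : Fin k => Measure.pi fun _ : Fin n => uniformLaw)).symm
    have h₄ := (measurePreserving_labelled_sample hreg hg n).prod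
      (MeasurePreserving.id (Measure.pi fun _ : Fin k => Measure.pi fun _ : Fin n => uniformLaw))
    convert h₄.comp (h₃.comp h₂) using 1
    funext p
    refine Prod.ext rfl (funext fun j => ?_)
    simp [MeasurableEquiv.piFinSuccAbove, MeasurableEquiv.prodAssoc, Fin.insertNthEquiv, Fin.init]
  have hζ : Measurable fun p : (Fin n → X) × (Fin n → ℝ) =>
      refVar fhat g fun i => labelled g (p.1 i, p.2 i) :=
    (measurable_refVar hf hreg.1 n).comp (measurePreserving_labelled_sample hreg hg n).measurable
  have hmain := prod_tagRank_le (Measure.pi fun _ : Fin n => Q.fst)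
    (Measure.pi fun _ : Fin n => uniformLaw) κ hκ hζ hq (Fin.last k)
  rw [← hmain]
  have hfull := hsplit.prod (MeasurePreserving.id κ)
  calc μ {ω | rankStat fhat g (fun i : Fin n => S i ω) (U n ω) (π n ω) ≤ q}
      = _ := hlaw.measure_preimage hE.nullMeasurableSet
    _ = _ := (hfull.measure_preimage hE.nullMeasurableSet).symm
    _ = _ := by
        congr 1
        ext p
        simp only [Set.mem_preimage, Set.mem_ofPred_eq, ← rankStat_succ]
        rfl

end Sample

/-! ### Consistency of the confidence region -/

theorem sqDiffClass_mem_Icc {X Θ : Type*} {f : Θ → X → ℝ}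
    (hf : ∀ θ x, f θ x ∈ Set.Icc (-1 : ℝ) 1) (p : Θ × Θ) (x : X) :
    sqDiffClass f p x ∈ Set.Icc (0 : ℝ) 4 := by
  have h₁ := hf p.1 x
  have h₂ := hf p.2 x
  refine ⟨sq_nonneg _, ?_⟩
  unfold sqDiffClass
  nlinarith [h₁.1, h₁.2, h₂.1, h₂.2]

theorem sq_sub_label_mem_Icc {a : ℝ} (ha : a ∈ Set.Icc (-1 : ℝ) 1) (y : Label) :
    (a - (y : ℝ)) ^ 2 ∈ Set.Icc (0 : ℝ) 4 := by
  have hy := label_mem_Icc y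
  refine ⟨sq_nonneg _, ?_⟩
  nlinarith [ha.1, ha.2, hy.1, hy.2]

/-! ### Population risks and separation of the ranks -/

section Population

variable {X Θ : Type*} [MeasurableSpace X] {Q : Measure (X × Label)} [IsProbabilityMeasure Q]
  {f : Θ → X → ℝ}

theorem measurable_sqDiffClass (hm : ∀ θ, Measurable (f θ)) (p : Θ × Θ) :
    Measurable (sqDiffClass f p) :=
  ((hm p.1).sub (hm p.2)).pow_const 2

theorem measurable_lossClass (hm : ∀ θ, Measurable (f θ)) (θ : Θ) :
    Measurable (lossClass f θ) :=
  (((hm θ).comp measurable_fst).sub (measurable_subtype_coe.comp measurable_snd)).pow_const 2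

theorem measurable_resampledLossClass (hm : ∀ θ, Measurable (f θ)) (p : Θ × Θ) :
    Measurable (resampledLossClass f p) :=
  (measurable_lossClass hm p.1).comp (measurable_labelled (hm p.2))

theorem integral_resampledLossClass (hm : ∀ θ, Measurable (f θ))
    (hf : ∀ θ x, f θ x ∈ Set.Icc (-1 : ℝ) 1) (p : Θ × Θ) :
    ∫ z, resampledLossClass f p z ∂(Q.fst.prod uniformLaw) =
      sqDistQ Q (f p.1) (f p.2) + ∫ x, (1 - f p.2 x ^ 2) ∂Q.fst :=
  integral_resampledLoss Q.fst (hm p.1) (hm p.2) (hf p.1) (hf p.2)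

/-- By `map_labelled_eq` the original risk is the resampled risk whose candidate is θ*. -/
theorem integral_lossClass (hm : ∀ θ, Measurable (f θ))
    (hf : ∀ θ x, f θ x ∈ Set.Icc (-1 : ℝ) 1) {θstar : Θ}
    (hreg : IsRegressionFunction Q (f θstar)) (θ : Θ) :
    ∫ z, lossClass f θ z ∂Q =
      sqDistQ Q (f θ) (f θstar) + ∫ x, (1 - f θstar x ^ 2) ∂Q.fst := by
  rw [← integral_resampledLossClass hm hf (θ, θstar)]
  conv_lhs => rw [← map_labelled_eq hreg (hf θstar)]
  rw [integral_map (measurable_labelled hreg.1).aemeasurable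
    (measurable_lossClass hm θ).aestronglyMeasurable]
  rfl

theorem sqDistQ_le_two_mul_add (hm : ∀ θ, Measurable (f θ))
    (hf : ∀ θ x, f θ x ∈ Set.Icc (-1 : ℝ) 1) (θ₁ θ₂ θ₃ : Θ) :
    sqDistQ Q (f θ₁) (f θ₃) ≤ 2 * sqDistQ Q (f θ₁) (f θ₂) + 2 * sqDistQ Q (f θ₂) (f θ₃) := by
  have hint : ∀ p : Θ × Θ, Integrable (fun x => (f p.1 x - f p.2 x) ^ 2) Q.fst := fun p =>
    integrable_of_mem_Icc (measurable_sqDiffClass hm p) (sqDiffClass_mem_Icc hf p)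
  unfold sqDistQ
  rw [← integral_const_mul, ← integral_const_mul,
    ← integral_add ((hint (θ₁, θ₂)).const_mul 2) ((hint (θ₂, θ₃)).const_mul 2)]
  refine integral_mono (hint (θ₁, θ₃))
    (((hint (θ₁, θ₂)).const_mul 2).add ((hint (θ₂, θ₃)).const_mul 2)) fun x => ?_
  simp only
  nlinarith [sq_nonneg ((f θ₁ x - f θ₂ x) - (f θ₂ x - f θ₃ x))]

/-- On samples where the three classes have uniform deviations at most `η`, every parameter at
a squared distance larger than `12 η` from the true one has the largest possible rank. -/
theorem rankStat_eq_of_deviation_le (hm : ∀ θ, Measurable (f θ))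
    (hf : ∀ θ x, f θ x ∈ Set.Icc (-1 : ℝ) 1) {θstar : Θ}
    (hreg : IsRegressionFunction Q (f θstar))
    {fhat : (n : ℕ) → (Fin n → X × Label) → X → ℝ} (hfhat : IsERM f fhat) {m : ℕ} [NeZero m]
    {n : ℕ} {D : Fin n → X × Label} {u : Fin (m - 1) → Fin n → ℝ} {η : ℝ}
    (hdiff : ∀ p, |(1 / (n : ℝ)) * ∑ k, sqDiffClass f p (D k).1 -
      ∫ w, sqDiffClass f p w ∂Q.fst| ≤ η)
    (hloss : ∀ θ, |(1 / (n : ℝ)) * ∑ k, lossClass f θ (D k) - ∫ w, lossClass f θ w ∂Q| ≤ η)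
    (hres : ∀ j p, |(1 / (n : ℝ)) * ∑ k, resampledLossClass f p ((D k).1, u j k) -
      ∫ w, resampledLossClass f p w ∂(Q.fst.prod uniformLaw)| ≤ η)
    {θ : Θ} (hθ : 12 * η < sqDistQ Q (f θ) (f θstar)) (σ : Equiv.Perm (Fin m)) :
    rankStat fhat (f θ) D u σ = m := by
  obtain ⟨θ₀, hθ₀⟩ := hfhat.mem_class n D
  -- With d the squared distance, d(θ, θ*) ≤ 2 d(θ, θ₀) + 2 d(θ₀, θ*). Minimality of θ₀ and two loss
  -- deviations give d(θ₀, θ*) ≤ 2η; the empirical distance costs another η.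
  have hZ₀ : sqDistQ Q (f θ) (f θstar) / 2 - 3 * η ≤ refVar fhat (f θ) D := by
    have hmin : (1 / (n : ℝ)) * ∑ k, lossClass f θ₀ (D k) ≤
        (1 / (n : ℝ)) * ∑ k, lossClass f θstar (D k) := by
      have := hfhat.minimizes n D θstar
      rwa [← hθ₀] at this
    have h₁ := abs_le.mp (hloss θ₀)
    have h₂ := abs_le.mp (hloss θstar)
    have h₃ := abs_le.mp (hdiff (θ, θ₀))
    have h₄ := sqDistQ_le_two_mul_add (Q := Q) hm hf θ θ₀ θstar
    rw [integral_lossClass hm hf hreg] at h₁ h₂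
    have h₅ : sqDistQ Q (f θstar) (f θstar) = 0 := by simp [sqDistQ]
    have h₆ : refVar fhat (f θ) D = (1 / (n : ℝ)) * ∑ k, sqDiffClass f (θ, θ₀) (D k).1 := by
      rw [refVar, ← hθ₀]
      rfl
    have h₇ : ∫ w, sqDiffClass f (θ, θ₀) w ∂Q.fst = sqDistQ Q (f θ) (f θ₀) := rfl
    linarith [h₁.2, h₂.1, h₃.1]
  -- Now θ itself competes with the minimizer θ', so d(θ', θ) ≤ 2η, plus η for the empirical
  -- distance.
  have hZ : ∀ j, refVar fhat (f θ) (resample (f θ) D (u j)) ≤ 3 * η := fun j => by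
    obtain ⟨θ', hθ'⟩ := hfhat.mem_class n (resample (f θ) D (u j))
    have hmin : (1 / (n : ℝ)) * ∑ k, resampledLossClass f (θ', θ) ((D k).1, u j k) ≤
        (1 / (n : ℝ)) * ∑ k, resampledLossClass f (θ, θ) ((D k).1, u j k) := by
      have := hfhat.minimizes n (resample (f θ) D (u j)) θ
      rwa [← hθ'] at this
    have h₁ := abs_le.mp (hres j (θ', θ))
    have h₂ := abs_le.mp (hres j (θ, θ))
    have h₃ := abs_le.mp (hdiff (θ, θ'))
    rw [integral_resampledLossClass hm hf] at h₁ h₂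
    simp only at h₁ h₂
    have h₅ : sqDistQ Q (f θ) (f θ) = 0 := by simp [sqDistQ]
    have h₆ : refVar fhat (f θ) (resample (f θ) D (u j)) =
        (1 / (n : ℝ)) * ∑ k, sqDiffClass f (θ, θ') (D k).1 := by
      rw [refVar, ← hθ']
      rfl
    have h₇ : ∫ w, sqDiffClass f (θ, θ') w ∂Q.fst = sqDistQ Q (f θ') (f θ) := by
      simp only [sqDistQ, sqDiffClass]
      exact integral_congr_ae (ae_of_all _ fun x => by ring)
    linarith [h₁.1, h₂.2, h₃.2]
  unfold rankStat
  have hlt : ∀ j : Fin (m - 1), TagLT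
      (refVar fhat (f θ) (resample (f θ) D (u j)), σ (Fin.castLE (Nat.sub_le m 1) j))
      (refVar fhat (f θ) D, σ ⟨m - 1, Nat.sub_one_lt (NeZero.ne m)⟩) :=
    fun j => Or.inl (show refVar _ _ _ < refVar _ _ _ by linarith [hZ j])
  simp only [hlt, if_true, Finset.sum_const, Finset.card_univ, Fintype.card_fin, smul_eq_mul,
    mul_one]
  have := NeZero.pos m
  omega

end Population

/-- A uniform law of large numbers along samples of growing size with prescribed marginal laws,
whatever their joint law. -/
theorem ae_eventually_deviation_le {Ω ι Z : Type*} [MeasurableSpace Ω] {μ : Measure Ω}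
    [MeasurableSpace Z] {P : Measure Z} [IsProbabilityMeasure P] [Nonempty ι] {h : ι → Z → ℝ}
    (hm : ∀ i, Measurable (h i)) (hb : ∀ i z, h i z ∈ Set.Icc (0 : ℝ) 4)
    (hcov : HasPolynomialCovers h) (hsup : MeasurableSuprema P h)
    {W : (n : ℕ) → Ω → Fin n → Z}
    (hW : ∀ n, MeasurePreserving (W n) μ (Measure.pi fun _ => P)) {ε : ℝ} (hε : 0 < ε) :
    ∀ᵐ ω ∂μ, ∀ᶠ n : ℕ in atTop, ∀ i,
      |(1 / (n : ℝ)) * ∑ k, h i (W n ω k) - ∫ w, h i w ∂P| ≤ ε := by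
  have hsum : ∑' n : ℕ, μ (W n ⁻¹'
      {z | ∃ i, ε < |(1 / (n : ℝ)) * ∑ k, h i (z k) - ∫ w, h i w ∂P|}) ≠ ⊤ :=
    ne_top_of_le_ne_top (tsum_measure_deviation_ne_top hm hb hcov hsup hε)
      (ENNReal.tsum_le_tsum fun n => (hW n).measure_preimage_le _)
  filter_upwards [ae_eventually_notMem hsum] with ω hω
  filter_upwards [hω] with n hn i
  by_contra hi
  exact hn ⟨i, not_le.mp hi⟩

theorem IsIIDSample.measurePreserving_sample {Ω X : Type*} [MeasurableSpace Ω] [MeasurableSpace X]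
    {μ : Measure Ω} [IsProbabilityMeasure μ] {Q : Measure (X × Label)} {S : ℕ → Ω → X × Label}
    (hS : IsIIDSample μ Q S) (n : ℕ) :
    MeasurePreserving (fun ω (i : Fin n) => S i ω) μ (Measure.pi fun _ => Q) :=
  ⟨hS.measurable_sample n, hS.map_sample n⟩

section Consistency

variable {Ω X : Type*} [MeasurableSpace Ω] [MeasurableSpace X] {μ : Measure Ω}
  [IsProbabilityMeasure μ] {Q : Measure (X × Label)} [IsProbabilityMeasure Q]
  {S : ℕ → Ω → X × Label}

theorem measurePreserving_inputs (Q : Measure (X × Label)) [IsProbabilityMeasure Q] (n : ℕ) :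
    MeasurePreserving (fun (D : Fin n → X × Label) i => (D i).1) (Measure.pi fun _ => Q)
      (Measure.pi fun _ => Q.fst) :=
  measurePreserving_pi (fun _ : Fin n => Q) (fun _ => Q.fst) (f := fun _ => Prod.fst)
    fun _ => ⟨measurable_fst, rfl⟩

/-- Provides the law required by the uniform law for the resampled class, separately for each j and
n; no joint law over j is needed because there are finitely many j. -/
theorem IsStemSample.measurePreserving_resampling {m : ℕ}
    {U : (n : ℕ) → Ω → Fin (m - 1) → Fin n → ℝ} {π : (n : ℕ) → Ω → Equiv.Perm (Fin m)}
    (hS : IsIIDSample μ Q S) (hstem : IsStemSample m μ S U π) (j : Fin (m - 1)) (n : ℕ) :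
    MeasurePreserving (fun ω (i : Fin n) => ((S i ω).1, U n ω j i)) μ
      (Measure.pi fun _ => Q.fst.prod uniformLaw) := by
  have h₁ : MeasurePreserving (fun ω => ((fun i : Fin n => S i ω), U n ω)) μ
      ((Measure.pi fun _ => Q).prod (Measure.pi fun _ => Measure.pi fun _ => uniformLaw)) :=
    ⟨(hS.measurable_sample n).prodMk (hstem.measurable_U n), hstem.map_sample_prod hS n⟩
  have h₂ := (measurePreserving_inputs Q n).prod (measurePreserving_eval
    (fun _ : Fin (m - 1) => Measure.pi fun _ : Fin n => uniformLaw) j)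
  have h₃ := (measurePreserving_arrowProdEquivProdArrow X ℝ (Fin n) (fun _ => Q.fst)
    (fun _ => uniformLaw)).symm
  exact h₃.comp (h₂.comp h₁)

end Consistency

end ERMRegion

/-! ### Exact coverage and strong consistency -/

theorem theorem2
    {Ω : Type*} [MeasurableSpace Ω] (μ : Measure Ω) [IsProbabilityMeasure μ]
    -- Euclidean input space
    {d : ℕ} (X : Set (EuclideanSpace ℝ (Fin d)))
    (Q : Measure (X × Label)) [IsProbabilityMeasure Q]
    -- i.i.d. sample from `Q`
    (S : ℕ → Ω → X × Label) (hS : IsIIDSample μ Q S)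
    -- candidate regression functions, containing the true one
    {Θ : Type*} [MetricSpace Θ] (f : Θ → X → ℝ)
    (hf_meas : ∀ θ, Measurable (f θ)) (hf_range : ∀ θ x, f θ x ∈ Set.Icc (-1 : ℝ) 1)
    (θstar : Θ) (hθstar : IsRegressionFunction Q (f θstar))
    -- injective parameterization
    (hinj : ∀ θ₁ θ₂ : Θ, θ₁ ≠ θ₂ → sqDistQ Q (f θ₁) (f θ₂) ≠ 0)
    -- inverse Lipschitz condition
    (hLip : ∃ L : ℝ, 0 < L ∧ ∀ θ₁ θ₂ : Θ, dist θ₁ θ₂ ≤ L * distQ Q (f θ₁) (f θ₂))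
    -- finite pseudo-dimension
    (hdim : pseudoDim (Set.range f) < ⊤)
    -- existence and measurability of the empirical risk minimizers
    (fhat : (n : ℕ) → (Fin n → X × Label) → X → ℝ) (hfhat : IsERM f fhat)
    -- measurability of the arising suprema
    (hsup_diff : MeasurableSuprema Q.fst (sqDiffClass f))
    (hsup_loss : MeasurableSuprema Q (lossClass f))
    (hsup_res : MeasurableSuprema (Q.fst.prod uniformLaw) (resampledLossClass f))
    -- the artificial randomness of the algorithm
    (m : ℕ) [NeZero m] (q : ℕ) (hq : q ≤ m)
    (U : (n : ℕ) → Ω → Fin (m - 1) → Fin n → ℝ) (π : (n : ℕ) → Ω → Equiv.Perm (Fin m))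
    (hstem : IsStemSample m μ S U π) :
    (∀ n : ℕ,
      μ {ω | θstar ∈ ermRegion q f fhat (fun i : Fin n => S i ω) (U n ω) (π n ω)}
        = (q : ℝ≥0∞) / (m : ℝ≥0∞)) ∧
    (q < m → ∀ ε : ℝ, 0 < ε → ∀ᵐ ω ∂μ, ∀ᶠ n : ℕ in atTop,
      ermRegion q f fhat (fun i : Fin n => S i ω) (U n ω) (π n ω) ⊆ Metric.ball θstar ε) := by
  have hne : Nonempty Θ := ⟨θstar⟩
  refine ⟨fun n => measure_rankStat_le hS hθstar (hf_range θstar) hfhat.measurable hq hstem n,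
    fun hqm ε hε => ?_⟩
  obtain ⟨L, hL, hLip⟩ := hLip
  -- Any η with 12η < (ε/L)² would do: parameters at Δ-distance at least ε have squared L² distance
  -- at least (ε/L)².
  set η : ℝ := (ε / L) ^ 2 / 16 with hη
  have hη0 : 0 < η := by positivity
  have hdiff := ae_eventually_deviation_le (measurable_sqDiffClass hf_meas)
    (sqDiffClass_mem_Icc hf_range) (hasPolynomialCovers_sqDiffClass hf_range hdim) hsup_diff
    (fun n => (measurePreserving_inputs Q n).comp (hS.measurePreserving_sample n)) hη0
  have hloss := ae_eventually_deviation_le (measurable_lossClass hf_meas)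
    (fun θ z => sq_sub_label_mem_Icc (hf_range θ z.1) z.2)
    (hasPolynomialCovers_lossClass hf_range hdim) hsup_loss
    (fun n => hS.measurePreserving_sample n) hη0
  have hres := ae_all_iff.mpr fun j => ae_eventually_deviation_le
    (measurable_resampledLossClass hf_meas)
    (fun p z => sq_sub_label_mem_Icc (hf_range p.1 z.1) _)
    (hasPolynomialCovers_resampledLossClass hf_range hdim) hsup_res
    (fun n => hstem.measurePreserving_resampling hS j n) hη0
  filter_upwards [hdiff, hloss, hres] with ω h₁ h₂ h₃
  filter_upwards [h₁, h₂, eventually_all.mpr h₃] with n h₁ h₂ h₃ θ hθ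
  by_contra hfar
  have hdist : ε ≤ dist θ θstar := not_lt.mp hfar
  have hQ : ε / L ≤ distQ Q (f θ) (f θstar) := by
    rw [div_le_iff₀' hL]
    exact hdist.trans (hLip θ θstar)
  have hsq : (ε / L) ^ 2 ≤ sqDistQ Q (f θ) (f θstar) :=
    (Real.le_sqrt' (by positivity)).mp hQ
  have hrank := rankStat_eq_of_deviation_le hf_meas hf_range hθstar hfhat h₁ h₂ h₃
    (θ := θ) (by linarith) (π n ω)
  have hle : rankStat fhat (f θ) (fun i : Fin n => S i ω) (U n ω) (π n ω) ≤ q := hθ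
  exact absurd (hrank.symm.trans_le hle) (not_le.mpr hqm)
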